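/- Let $\Omega\subset\mathbb{R}^d$ be compact and convex, let $\mu,\nu$ be Borel probability measures on $\Omega$, and assume that $\mu$ is absolutely continuous with respect to Lebesgue measure. Put $W_1(\mu,\nu)=\inf_{\gamma}\int|x-y|\,d\gamma$, the infimum being over all measures $\gamma$ with marginals $\mu$ and $\nu$. A Kantorovich potential for $(\mu,\nu)$ is a function $u$, Lipschitz with constant $1$ on $\Omega$, that maximizes $\int u\,d\mu-\int u\,d\nu$ among all such functions. An optimal map for $(\mu,\nu)$ is a ($\mu$-a.e. defined, $\mu$-measurable) map $T$ that minimizes $\int|x-T(x)|\,d\mu$ among all maps with $T_\#\mu=\nu$, and its minimal transport length is $\ell_0(T)=\operatorname{ess\,inf}_\mu|x-T(x)|$. Let $u_0$ be a Kantorovich potential and $T_0$ an optimal map for $(\mu,\nu)$, and let $0\le\eta_0<\ell_0(T_0)$. Define $$f_0(x)=x-\eta_0\nabla u_0(x),\qquad g_0(x)=x+\eta_0\nabla u_0(x)$$ at the points $x\in\Omega$ where $\nabla u_0(x)$ exists, and $f_0(x)=g_0(x)=x$ elsewhere. Set $\tilde\mu=(f_0)_\#\mu$. Then $\tilde\mu$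 is a probability measure on $\Omega$, and: (i) $u_0$ is a Kantorovich potential for $(\tilde\mu,\nu)$; (ii) $W_1(\tilde\mu,\nu)=W_1(\mu,\nu)-\eta_0$, both distances being finite; (iii) $T_1=T_0\circ g_0$ is an optimal map for $(\tilde\mu,\nu)$, and its minimal transport length, taken with respect to $\tilde\mu$, satisfies $\ell_0(T_1)\ge\ell_0(T_0)-\eta_0$; (iv) $\tilde\mu$ is absolutely continuous with respect to Lebesgue measure, and if $\rho$ and $\tilde\rho$ are densities of $\mu$ and $\tilde\mu$, then for $\mu$-almost every $x$ the map $g_0$ is approximately differentiable at $f_0(x)$ and $$\tilde\rho(f_0(x))=\rho(x)\,|Dg_0(f_0(x))|,$$ where $|Dg_0(y)|$ is the absolute value of the determinant of the approximate derivative of $g_0$ at $y$. (A linear map $L$ is the approximate derivative of $g$ at $y$ if for every $\varepsilon>0$ the set $\{z: |g(z)-g(y)-L(z-y)|>\varepsilon|z-y|\}$ has Lebesgue density $0$ at $y$.) -/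

import Mathlib

open MeasureTheory Filter Topology
open scoped ENNReal NNReal

/-- `ℝ^d` with the Euclidean norm. -/
abbrev E (d : ℕ) : Type := EuclideanSpace ℝ (Fin d)

/-- `μ ∈ 𝒫(Ω)`: a Borel probability measure on `ℝ^d` that is concentrated on `Ω`. -/
def IsProbOn {d : ℕ} (Ω : Set (E d)) (μ : Measure (E d)) : Prop :=
  IsProbabilityMeasure μ ∧ μ Ωᶜ = 0

/-- The admissible plans `Π(μ, ν)`: measures on the product with marginals `μ` and `ν`. -/
def admissiblePlans {d : ℕ} (μ ν : Measure (E d)) : Set (Measure (E d × E d)) :=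
  {γ | γ.map Prod.fst = μ ∧ γ.map Prod.snd = ν}

/-- The Wasserstein-1 distance, as the value of the Kantorovich minimization problem
`inf_{γ ∈ Π(μ, ν)} ∫ |x - y| dγ`. -/
noncomputable def W1 {d : ℕ} (μ ν : Measure (E d)) : ℝ≥0∞ :=
  ⨅ γ ∈ admissiblePlans μ ν, ∫⁻ p, edist p.1 p.2 ∂γ

/-- `T` is an optimal transport map for `(μ, ν)`: it minimizes `∫ |x - T x| dμ` among all maps
pushing `μ` forward to `ν`. Maps are only considered up to `μ`-null sets; when `ν` is concentrated
on `Ω`, the condition `T_# μ = ν` forces `T x ∈ Ω` for `μ`-almost every `x`. -/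
structure IsOptimalMap {d : ℕ} (μ ν : Measure (E d)) (T : E d → E d) : Prop where
  aemeasurable : AEMeasurable T μ
  map_eq : μ.map T = ν
  le : ∀ S : E d → E d, AEMeasurable S μ → μ.map S = ν →
    ∫⁻ x, edist x (T x) ∂μ ≤ ∫⁻ x, edist x (S x) ∂μ

/-- `u` is a Kantorovich potential for `(μ, ν)`: it maximizes `∫ u dμ - ∫ u dν` among the
functions that are Lipschitz with constant `1` on `Ω`. -/
structure IsKantorovichPotential {d : ℕ} (Ω : Set (E d)) (μ ν : Measure (E d))
    (u : E d → ℝ) : Prop where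
  lipschitz : LipschitzOnWith 1 u Ω
  le : ∀ v : E d → ℝ, LipschitzOnWith 1 v Ω →
    ∫ x, v x ∂μ - ∫ y, v y ∂ν ≤ ∫ x, u x ∂μ - ∫ y, u y ∂ν

/-- `ℓ₀(T)`: the minimal transport length, i.e. the `μ`-essential infimum of `|x - T x|`. -/
noncomputable def minTransportLength {d : ℕ} (μ : Measure (E d)) (T : E d → E d) : ℝ :=
  essInf (fun x => ‖x - T x‖) μ

open Classical in
/-- `f(x) = x - η ∇u(x)` where the gradient of `u : Ω → ℝ` exists, and `f(x) = x` elsewhere. -/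
noncomputable def descentMap {d : ℕ} (Ω : Set (E d)) (u : E d → ℝ) (η : ℝ) (x : E d) : E d :=
  if x ∈ Ω ∧ DifferentiableWithinAt ℝ u Ω x then x - η • gradientWithin u Ω x else x

open Classical in
/-- `g(x) = x + η ∇u(x)` where the gradient of `u : Ω → ℝ` exists, and `g(x) = x` elsewhere. -/
noncomputable def ascentMap {d : ℕ} (Ω : Set (E d)) (u : E d → ℝ) (η : ℝ) (x : E d) : E d :=
  if x ∈ Ω ∧ DifferentiableWithinAt ℝ u Ω x then x + η • gradientWithin u Ω x else x

/-- `L` is the approximate derivative of `g` at `y`: for every `ε > 0` the set of points `z` with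
`|g z - g y - L (z - y)| > ε |z - y|` has Lebesgue density `0` at `y`. -/
def HasApproxFDerivAt {d : ℕ} (g : E d → E d) (L : E d →L[ℝ] E d) (y : E d) : Prop :=
  ∀ ε : ℝ, 0 < ε →
    Tendsto (fun r : ℝ =>
      volume ({z | ε * ‖z - y‖ < ‖g z - g y - L (z - y)‖} ∩ Metric.closedBall y r) /
        volume (Metric.closedBall y r))
      (𝓝[>] 0) (𝓝 0)

/-- `ρ` is a density of `μ` with respect to Lebesgue measure. -/
def IsDensity {d : ℕ} (ρ : E d → ℝ≥0∞) (μ : Measure (E d)) : Prop :=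
  AEMeasurable ρ volume ∧ μ = volume.withDensity ρ

/-!
The proof rests on duality and on the geometry of transport rays.

*Duality.* On a compact space, Hahn–Banach and the Riesz representation theorem give a plan whose
cost is at most the maximal dual value `∫ u₀ dμ - ∫ u₀ dν` (`exists_plan_le_dual`). As `μ` has no
atoms, plans can be approximated by maps (`exists_map_lintegral_le_add`): within each cell of a fine
partition, any law of the right mass is the image of `μ` under some map. Hence the optimal map `T₀`,
which competes only with maps, also has cost at most the dual value, and complementary slackness
gives `u₀ x - u₀ (T₀ x) = |x - T₀ x|` for almost every `x` (`ae_sub_eq_norm_sub`). Conversely, a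
map whose cost is bounded by a dual value certifies the optimality of both
(`optimality_of_lintegral_le_dual`).

*Rays.* So `u₀` has slope `-1` on the segment from `x` to `T₀ x`. Where `u₀` is differentiable,
which by Rademacher's theorem is almost everywhere, its gradient is the unit vector pointing from
`T₀ x` to `x`. The point `x - η₀ ∇u₀(x)` therefore lies on the segment; there the potential and the
distance to `T₀ x` have both dropped by `η₀`, and `u₀` has the same gradient, so that `g₀` undoes
`f₀` (`descent_along_ray`). Thus `T₀ ∘ g₀` and `u₀` certify each other for the pair of `f₀ # μ` and
`ν`, which gives the assertions on potentials, distances and optimal maps.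

*Density.* In the middle of a ray `u₀` is squeezed between two cones, so that it agrees with its
linearization up to a quadratic error with a constant depending only on the distance `r` to the ends
of the ray. Comparing the expansions at two points shows that `∇u₀` is `3 / r`-Lipschitz on the set
of all points at distance at least `r` from both ends (`norm_sub_le_of_rays`). If `η₀ > 0`, all
points `f₀ x` are at least `min η₀ (ℓ₀ - η₀)` away from both ends, so `g₀` agrees with a Lipschitz
map on a set that carries `f₀ # μ`; for `η₀ = 0` it is the identity. Absolute continuity and the
Jacobian equation follow from the change of variables formula for this Lipschitz map
(`density_map_eq_mul_abs_det`), and `g₀` is approximately differentiable at the density points of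
that set (`hasApproxFDerivAt_of_eqOn`).
-/

/-! ### Kantorovich–Rubinstein duality on compact metric spaces -/

section Duality

variable {X : Type*} [MetricSpace X] [CompactSpace X]

theorem ContinuousMap.integrable_of_compactSpace {Y : Type*} [TopologicalSpace Y] [CompactSpace Y]
    [MeasurableSpace Y] [BorelSpace Y] {m : Measure Y} [IsFiniteMeasure m] {f : Y → ℝ}
    (hf : Continuous f) : Integrable f m :=
  integrableOn_univ.1 (hf.continuousOn.integrableOn_compact' isCompact_univ MeasurableSet.univ)

/-- The infimal convolution of a continuous function with `s * dist`. -/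
noncomputable def infConv (s : ℝ) (v : C(X, ℝ)) (x : X) : ℝ := ⨅ y, (s * dist x y + v y)

theorem infConv_bddBelow {s : ℝ} (hs : 0 ≤ s) (v : C(X, ℝ)) (x : X) :
    BddBelow (Set.range fun y => s * dist x y + v y) := by
  refine ⟨-‖v‖, ?_⟩
  rintro _ ⟨y, rfl⟩
  have := (abs_le.1 (v.norm_coe_le_norm y)).1
  have := mul_nonneg hs (dist_nonneg (x := x) (y := y))
  simp only
  linarith

theorem infConv_le_add {s : ℝ} (hs : 0 ≤ s) (v : C(X, ℝ)) (x x' : X) :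
    infConv s v x ≤ infConv s v x' + s * dist x x' := by
  have : Nonempty X := ⟨x⟩
  rw [← sub_le_iff_le_add]
  refine le_ciInf fun y => ?_
  have h1 : infConv s v x ≤ s * dist x y + v y := ciInf_le (infConv_bddBelow hs v x) y
  have h2 := mul_le_mul_of_nonneg_left (dist_triangle x x' y) hs
  linarith

theorem continuous_infConv {s : ℝ} (hs : 0 ≤ s) (v : C(X, ℝ)) : Continuous (infConv s v) := by
  refine (LipschitzWith.of_le_add_mul s.toNNReal fun x y => ?_).continuous
  rw [Real.coe_toNNReal _ hs]
  exact infConv_le_add hs v x y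

variable [MeasurableSpace X] {μ ν : Measure X}

theorem integral_infConv_sub_le [IsProbabilityMeasure μ] [IsProbabilityMeasure ν] {D : ℝ}
    (hD : ∀ v : X → ℝ, LipschitzWith 1 v → ∫ x, v x ∂μ - ∫ y, v y ∂ν ≤ D)
    {s : ℝ} (hs : 0 ≤ s) (v : C(X, ℝ)) :
    ∫ x, infConv s v x ∂μ - ∫ x, infConv s v x ∂ν ≤ s * D := by
  rcases hs.eq_or_lt with rfl | hs
  · simp [infConv]
  · have hl : LipschitzWith 1 fun x => s⁻¹ * infConv s v x := by
      refine LipschitzWith.of_le_add fun x y => ?_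
      have := mul_le_mul_of_nonneg_left (infConv_le_add hs.le v x y) (inv_pos.2 hs).le
      rwa [mul_add, inv_mul_cancel_left₀ hs.ne'] at this
    have := hD _ hl
    rw [integral_const_mul, integral_const_mul, ← mul_sub] at this
    rwa [inv_mul_le_iff₀ hs] at this

/-- The values `∫ u dμ + ∫ v dν + s * D` over all `(u, v, s)` with `s ≥ 0` and
`φ (x, y) ≤ u x + v y + s * dist x y`. Their infimum is a sublinear function of `φ`. The multiple
of the distance is included so that a linear functional below this infimum is automatically at most `D`
at `dist`, without prescribing its value there. -/
def dualValues (μ ν : Measure X) (D : ℝ) (φ : C(X × X, ℝ)) : Set ℝ :=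
  {r | ∃ (u v : C(X, ℝ)) (s : ℝ), 0 ≤ s ∧ (∀ x y, φ (x, y) ≤ u x + v y + s * dist x y) ∧
    r = ∫ x, u x ∂μ + ∫ y, v y ∂ν + s * D}

theorem norm_mem_dualValues [IsProbabilityMeasure μ] (D : ℝ) (φ : C(X × X, ℝ)) :
    ‖φ‖ ∈ dualValues μ ν D φ :=
  ⟨.const X ‖φ‖, 0, 0, le_rfl, fun x y => by
    simpa using (le_abs_self _).trans (φ.norm_coe_le_norm (x, y)), by simp⟩

theorem smul_mem_dualValues {Y : Type*} [MetricSpace Y] [MeasurableSpace Y] {μ ν : Measure Y}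
    {D c r : ℝ} (hc : 0 ≤ c) {φ : C(Y × Y, ℝ)} (hr : r ∈ dualValues μ ν D φ) :
    c * r ∈ dualValues μ ν D (c • φ) := by
  obtain ⟨u, v, s, hs, h, rfl⟩ := hr
  refine ⟨c • u, c • v, c * s, mul_nonneg hc hs, fun x y => ?_, ?_⟩
  · have := mul_le_mul_of_nonneg_left (h x y) hc
    simp only [ContinuousMap.smul_apply, smul_eq_mul]
    linarith
  · simp only [ContinuousMap.smul_apply, smul_eq_mul, integral_const_mul]
    ring

variable [BorelSpace X] [IsProbabilityMeasure μ] [IsProbabilityMeasure ν]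

/-- A lower bound for `u x + v y + s * dist x y` is one for `∫ u dμ + ∫ v dν + s * D`: the infimal
convolution of `v` with `s * dist` is `s`-Lipschitz and lies between `-M - u` and `v`. Hence the
infimum of the dual values is finite. -/
theorem neg_le_dual_value {D : ℝ}
    (hD : ∀ v : X → ℝ, LipschitzWith 1 v → ∫ x, v x ∂μ - ∫ y, v y ∂ν ≤ D)
    {s M : ℝ} (hs : 0 ≤ s) (u v : C(X, ℝ)) (h : ∀ x y, -M ≤ u x + v y + s * dist x y) :
    -M ≤ ∫ x, u x ∂μ + ∫ y, v y ∂ν + s * D := by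
  have hc := continuous_infConv hs v
  have h1 : ∫ x, (-M - u x) ∂μ ≤ ∫ x, infConv s v x ∂μ := by
    refine integral_mono (ContinuousMap.integrable_of_compactSpace (by fun_prop))
      (ContinuousMap.integrable_of_compactSpace hc) fun x => ?_
    have : Nonempty X := ⟨x⟩
    refine le_ciInf fun y => ?_
    linarith [h x y]
  have h2 : ∫ x, infConv s v x ∂ν ≤ ∫ x, v x ∂ν := by
    refine integral_mono (ContinuousMap.integrable_of_compactSpace hc)
      (ContinuousMap.integrable_of_compactSpace v.continuous) fun x => ?_
    exact (ciInf_le (infConv_bddBelow hs v x) x).trans (by simp)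
  have h3 := integral_infConv_sub_le hD hs v
  rw [integral_sub (integrable_const _) (ContinuousMap.integrable_of_compactSpace u.continuous)]
    at h1
  simp at h1
  linarith

theorem neg_norm_le_of_mem_dualValues {D : ℝ}
    (hD : ∀ v : X → ℝ, LipschitzWith 1 v → ∫ x, v x ∂μ - ∫ y, v y ∂ν ≤ D)
    {φ : C(X × X, ℝ)} {r : ℝ} (hr : r ∈ dualValues μ ν D φ) : -‖φ‖ ≤ r := by
  obtain ⟨u, v, s, hs, h, rfl⟩ := hr
  exact neg_le_dual_value hD hs u v fun x y =>
    (abs_le.1 (φ.norm_coe_le_norm (x, y))).1.trans (h x y)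

theorem add_mem_dualValues {D r r' : ℝ} {φ ψ : C(X × X, ℝ)}
    (hr : r ∈ dualValues μ ν D φ) (hr' : r' ∈ dualValues μ ν D ψ) :
    r + r' ∈ dualValues μ ν D (φ + ψ) := by
  obtain ⟨u, v, s, hs, h, rfl⟩ := hr
  obtain ⟨u', v', s', hs', h', rfl⟩ := hr'
  refine ⟨u + u', v + v', s + s', add_nonneg hs hs', fun x y => ?_, ?_⟩
  · simp only [ContinuousMap.add_apply]
    linarith [h x y, h' x y]
  · have hi (m : Measure X) [IsFiniteMeasure m] (w : C(X, ℝ)) : Integrable (fun x => w x) m :=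
      ContinuousMap.integrable_of_compactSpace w.continuous
    simp only [ContinuousMap.add_apply]
    rw [integral_add (hi _ _) (hi _ _), integral_add (hi _ _) (hi _ _)]
    ring

/-- The Hahn–Banach theorem, applied to the infimum of the dual values and the zero functional on
the zero subspace. -/
theorem exists_linear_le_dualValues {D : ℝ}
    (hD : ∀ v : X → ℝ, LipschitzWith 1 v → ∫ x, v x ∂μ - ∫ y, v y ∂ν ≤ D) :
    ∃ g : C(X × X, ℝ) →ₗ[ℝ] ℝ, ∀ φ, ∀ r ∈ dualValues μ ν D φ, g φ ≤ r := by
  have hb (φ : C(X × X, ℝ)) : BddBelow (dualValues μ ν D φ) :=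
    ⟨_, fun r hr => neg_norm_le_of_mem_dualValues hD hr⟩
  have hn (φ : C(X × X, ℝ)) : (dualValues μ ν D φ).Nonempty := ⟨_, norm_mem_dualValues D φ⟩
  have hle (c : ℝ) (hc : 0 < c) (φ : C(X × X, ℝ)) :
      sInf (dualValues μ ν D (c • φ)) ≤ c * sInf (dualValues μ ν D φ) := by
    rw [← inv_mul_le_iff₀ hc]
    refine le_csInf (hn φ) fun r hr => ?_
    rw [inv_mul_le_iff₀ hc]
    exact csInf_le (hb _) (smul_mem_dualValues hc.le hr)
  obtain ⟨g, -, hg⟩ := exists_extension_of_le_sublinear (⊥ : C(X × X, ℝ) →ₗ.[ℝ] ℝ)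
    (fun φ => sInf (dualValues μ ν D φ))
    (fun c hc φ => by
      refine le_antisymm (hle c hc φ) ?_
      have := hle c⁻¹ (inv_pos.2 hc) (c • φ)
      rwa [inv_smul_smul₀ hc.ne', le_inv_mul_iff₀ hc] at this)
    (fun φ ψ => by
      rw [← sub_le_iff_le_add]
      refine le_csInf (hn φ) fun r hr => ?_
      rw [sub_le_comm]
      refine le_csInf (hn ψ) fun r' hr' => ?_
      rw [sub_le_iff_le_add']
      exact csInf_le (hb _) (add_mem_dualValues hr hr'))
    (fun x => by
      have hx : x = 0 := Subtype.ext ((Submodule.mem_bot ℝ).1 x.2)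
      subst hx
      rw [LinearPMap.map_zero]
      refine le_csInf (hn _) fun r hr => ?_
      simpa using neg_norm_le_of_mem_dualValues hD hr)
  exact ⟨g, fun φ r hr => (hg φ).trans (csInf_le (hb φ) hr)⟩

/-- **Kantorovich–Rubinstein duality** on a compact metric space: a plan whose cost is at most the
value of the dual problem. -/
theorem exists_plan_le_dual {D : ℝ}
    (hD : ∀ v : X → ℝ, LipschitzWith 1 v → ∫ x, v x ∂μ - ∫ y, v y ∂ν ≤ D) :
    ∃ γ : Measure (X × X), γ.map Prod.fst = μ ∧ γ.map Prod.snd = ν ∧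
      ∫⁻ p, edist p.1 p.2 ∂γ ≤ ENNReal.ofReal D := by
  obtain ⟨g, hg⟩ := exists_linear_le_dualValues hD
  -- Special triples `(u, v, s)` show that `g` is positive, has marginals `μ` and `ν`, and is at
  -- most `D` at the distance.
  have hpos (φ : C(X × X, ℝ)) (hφ : 0 ≤ φ) : 0 ≤ g φ := by
    have := hg (-φ) 0 ⟨0, 0, 0, le_rfl, fun x y => by simpa using hφ (x, y), by simp⟩
    rw [map_neg] at this
    linarith
  have hfst (u : C(X, ℝ)) : g (u.comp ⟨Prod.fst, continuous_fst⟩) = ∫ x, u x ∂μ := by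
    have key (w : C(X, ℝ)) : g (w.comp ⟨Prod.fst, continuous_fst⟩) ≤ ∫ x, w x ∂μ :=
      hg _ _ ⟨w, 0, 0, le_rfl, fun x y => by simp, by simp⟩
    refine le_antisymm (key u) ?_
    have := key (-u)
    rw [ContinuousMap.neg_comp, map_neg] at this
    simp only [ContinuousMap.neg_apply, integral_neg] at this
    linarith
  have hsnd (u : C(X, ℝ)) : g (u.comp ⟨Prod.snd, continuous_snd⟩) = ∫ x, u x ∂ν := by
    have key (w : C(X, ℝ)) : g (w.comp ⟨Prod.snd, continuous_snd⟩) ≤ ∫ x, w x ∂ν :=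
      hg _ _ ⟨0, w, 0, le_rfl, fun x y => by simp, by simp⟩
    refine le_antisymm (key u) ?_
    have := key (-u)
    rw [ContinuousMap.neg_comp, map_neg] at this
    simp only [ContinuousMap.neg_apply, integral_neg] at this
    linarith
  have hdist : g ⟨fun p => dist p.1 p.2, by fun_prop⟩ ≤ D :=
    hg _ _ ⟨0, 0, 1, zero_le_one, fun x y => by simp, by simp⟩
  let Λ : CompactlySupportedContinuousMap (X × X) ℝ →ₚ[ℝ] ℝ := PositiveLinearMap.mk₀
    { toFun := fun f => g f.toContinuousMap
      map_add' := fun f f' => map_add g f.toContinuousMap f'.toContinuousMap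
      map_smul' := fun c f => map_smul g c f.toContinuousMap }
    (fun f hf => hpos f.toContinuousMap hf)
  let γ := RealRMK.rieszMeasure Λ
  have hγ (φ : C(X × X, ℝ)) : ∫ p, φ p ∂γ = g φ :=
    RealRMK.integral_rieszMeasure Λ (CompactlySupportedContinuousMap.continuousMapEquiv φ)
  have : IsFiniteMeasure γ := inferInstance
  refine ⟨γ, ?_, ?_, ?_⟩
  · refine ext_of_forall_integral_eq_of_IsFiniteMeasure fun f => ?_
    rw [integral_map measurable_fst.aemeasurable f.continuous.aestronglyMeasurable]
    exact (hγ (f.toContinuousMap.comp ⟨Prod.fst, continuous_fst⟩)).trans (hfst f.toContinuousMap)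
  · refine ext_of_forall_integral_eq_of_IsFiniteMeasure fun f => ?_
    rw [integral_map measurable_snd.aemeasurable f.continuous.aestronglyMeasurable]
    exact (hγ (f.toContinuousMap.comp ⟨Prod.snd, continuous_snd⟩)).trans (hsnd f.toContinuousMap)
  · have hc : Continuous fun p : X × X => dist p.1 p.2 := by fun_prop
    simp only [edist_dist]
    rw [← ofReal_integral_eq_lintegral_ofReal (ContinuousMap.integrable_of_compactSpace hc)
      (Eventually.of_forall fun p => dist_nonneg)]
    exact ENNReal.ofReal_le_ofReal ((hγ ⟨_, hc⟩).trans_le hdist)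

end Duality

/-! ### Transport maps from atomless measures -/

section AtomlessTransport

open ProbabilityTheory unitInterval

theorem continuous_cdf_of_nullSingletonClass (m : Measure ℝ) [IsProbabilityMeasure m]
    [NullSingletonClass m] :
    Continuous (cdf m) := by
  refine continuous_iff_continuousAt.2 fun a => ?_
  rw [(monotone_cdf m).continuousAt_iff_leftLim_eq_rightLim]
  have h1 : (cdf m).measure {a} = 0 := by rw [measure_cdf]; exact measure_singleton a
  rw [StieltjesFunction.measure_singleton, ENNReal.ofReal_eq_zero] at h1
  rw [StieltjesFunction.rightLim_eq]
  exact le_antisymm ((monotone_cdf m).leftLim_le le_rfl) (by linarith)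

/-- The distribution function of an atomless law on `ℝ` pushes it to the uniform law. -/
theorem exists_measurable_map_real_eq_volume (m : Measure ℝ) [IsProbabilityMeasure m]
    [NullSingletonClass m] : ∃ h : ℝ → I, Measurable h ∧ m.map h = volume := by
  have hc := continuous_cdf_of_nullSingletonClass m
  have hmeas : Measurable (fun x => (⟨cdf m x, cdf_nonneg m x, cdf_le_one m x⟩ : I)) :=
    (hc.subtype_mk _).measurable
  have hsurj (t : ℝ) (h0 : 0 < t) (h1 : t < 1) : ∃ a, cdf m a = t := by
    obtain ⟨a, ha⟩ := ((tendsto_cdf_atBot m).eventually (gt_mem_nhds h0)).exists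
    obtain ⟨b, hb⟩ := ((tendsto_cdf_atTop m).eventually (lt_mem_nhds h1)).exists
    exact mem_range_of_exists_le_of_exists_ge hc ⟨a, ha.le⟩ ⟨b, hb.le⟩
  have := Measure.isProbabilityMeasure_map (μ := m) hmeas.aemeasurable
  refine ⟨_, hmeas, Measure.ext_of_Iic _ _ fun t => ?_⟩
  rw [Measure.map_apply hmeas measurableSet_Iic, unitInterval.volume_Iic]
  have hset : (fun x => (⟨cdf m x, cdf_nonneg m x, cdf_le_one m x⟩ : I)) ⁻¹' Set.Iic t =
      {x | cdf m x ≤ t} := rfl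
  rw [hset]
  refine le_antisymm ?_ ?_
  · rcases t.2.2.eq_or_lt with h1 | h1
    · rw [h1]; simpa using prob_le_one
    · have ht : Tendsto ENNReal.ofReal (𝓝[>] (t : ℝ)) (𝓝 (ENNReal.ofReal t)) :=
        ENNReal.continuous_ofReal.continuousWithinAt
      refine ge_of_tendsto ht ?_
      filter_upwards [Ioo_mem_nhdsGT h1] with s hs
      obtain ⟨a, ha⟩ := hsurj s (t.2.1.trans_lt hs.1) hs.2
      rw [← ha, ofReal_cdf]
      refine measure_mono fun x (hx : cdf m x ≤ t) => ?_
      by_contra hxa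
      have := monotone_cdf m (not_le.1 hxa).le
      linarith [hs.1]
  · rcases t.2.1.eq_or_lt with h0 | h0
    · rw [← h0]; simp
    · rcases t.2.2.eq_or_lt with h1 | h1
      · have : {x | cdf m x ≤ t} = Set.univ := by
          ext x; simpa [h1] using cdf_le_one m x
        rw [this, h1]; simp
      · obtain ⟨a, ha⟩ := hsurj t h0 h1
        rw [← ha, ofReal_cdf]
        exact measure_mono fun x hx => monotone_cdf m hx

variable {X Y : Type*} [MeasurableSpace X] [StandardBorelSpace X] [MeasurableSpace Y]
  [StandardBorelSpace Y]

/-- An atomless law on a standard Borel space is pushed to the uniform law by some map. -/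
theorem exists_measurable_map_eq_volume (μ : Measure X) [IsProbabilityMeasure μ]
    [NullSingletonClass μ] :
    ∃ h : X → I, Measurable h ∧ μ.map h = volume := by
  have he := measurableEmbedding_embeddingReal X
  have hp := Measure.isProbabilityMeasure_map (μ := μ) he.measurable.aemeasurable
  have hn : NullSingletonClass (μ.map (embeddingReal X)) := ⟨fun r => by
    rw [he.map_apply]
    exact (Set.subsingleton_singleton.preimage he.injective).measure_zero μ⟩
  obtain ⟨h, hh, hm⟩ := exists_measurable_map_real_eq_volume (μ.map (embeddingReal X))
  exact ⟨h ∘ embeddingReal X, hh.comp he.measurable, by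
    rw [← Measure.map_map hh he.measurable, hm]⟩

/-- Atomless measures can be pushed to any measure of the same mass. -/
theorem exists_measurable_map_eq_of_nullSingletonClass (μ : Measure X) [IsFiniteMeasure μ]
    [NullSingletonClass μ] (ν : Measure Y) [IsFiniteMeasure ν] [Nonempty Y]
    (h : μ Set.univ = ν Set.univ) :
    ∃ S : X → Y, Measurable S ∧ μ.map S = ν := by
  by_cases h0 : μ Set.univ = 0
  · refine ⟨fun _ => Classical.arbitrary Y, measurable_const, ?_⟩
    rw [Measure.measure_univ_eq_zero.1 h0, Measure.measure_univ_eq_zero.1 (h.symm.trans h0),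
      Measure.map_zero]
  · have hc0 : (μ Set.univ)⁻¹ ≠ 0 := ENNReal.inv_ne_zero.2 (measure_ne_top _ _)
    have hct : (μ Set.univ)⁻¹ ≠ ∞ := ENNReal.inv_ne_top.2 h0
    have hμ : IsProbabilityMeasure ((μ Set.univ)⁻¹ • μ) :=
      ⟨by simpa using ENNReal.inv_mul_cancel h0 (measure_ne_top _ _)⟩
    have hν : IsProbabilityMeasure ((μ Set.univ)⁻¹ • ν) :=
      ⟨by simpa [← h] using ENNReal.inv_mul_cancel h0 (measure_ne_top _ _)⟩
    have hn : NullSingletonClass ((μ Set.univ)⁻¹ • μ) := ⟨fun x => by simp⟩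
    obtain ⟨f, hf, hfm⟩ := exists_measurable_map_eq_volume ((μ Set.univ)⁻¹ • μ)
    obtain ⟨k, hk, hkm⟩ := Measure.exists_measurable_map_eq ((μ Set.univ)⁻¹ • ν)
    refine ⟨k ∘ f, hk.comp hf, ?_⟩
    have h1 : ((μ Set.univ)⁻¹ • μ).map (k ∘ f) = (μ Set.univ)⁻¹ • ν := by
      rw [← Measure.map_map hk hf, hfm, hkm]
    rw [Measure.map_smul] at h1
    have h2 := congrArg (fun m => μ Set.univ • m) h1
    simpa only [smul_smul, ENNReal.mul_inv_cancel h0 (measure_ne_top _ _), one_smul] using h2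

theorem measure_eq_tsum_fiber {Z : Type*} [MeasurableSpace Z] (m : Measure Z) {N : Z → ℕ}
    (hN : Measurable N) {A : Set Z} (hA : MeasurableSet A) :
    m A = ∑' n, m (A ∩ N ⁻¹' {n}) := by
  rw [← measure_iUnion]
  · congr 1
    ext z
    simp
  · intro i j hij
    refine Set.disjoint_left.2 fun z hz hz' => hij ?_
    exact (Set.mem_singleton_iff.1 hz.2).symm.trans (Set.mem_singleton_iff.1 hz'.2)
  · exact fun n => hA.inter (hN (measurableSet_singleton n))

/-- A plan with atomless first marginal agrees with one given by a map, when the first coordinate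
is only observed through a countable partition. -/
theorem exists_measurable_map_eq_of_countable_partition {μ : Measure X} [NullSingletonClass μ]
    {γ : Measure (X × Y)} [IsFiniteMeasure γ] [Nonempty Y] (hγ : γ.map Prod.fst = μ)
    {N : X → ℕ} (hN : Measurable N) :
    ∃ S : X → Y, Measurable S ∧
      μ.map (fun x => (N x, S x)) = γ.map (fun p => (N p.1, p.2)) := by
  have hfin : IsFiniteMeasure μ := hγ ▸ inferInstance
  have hcell (n : ℕ) : ∃ S : X → Y, Measurable S ∧ (μ.restrict (N ⁻¹' {n})).map S =
      (γ.restrict ((fun p => N p.1) ⁻¹' {n})).map Prod.snd := by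
    refine exists_measurable_map_eq_of_nullSingletonClass _ _ ?_
    rw [Measure.map_apply measurable_snd MeasurableSet.univ, Set.preimage_univ,
      Measure.restrict_apply_univ, Measure.restrict_apply_univ, ← hγ,
      Measure.map_apply measurable_fst (hN (measurableSet_singleton n))]
    rfl
  choose S hS hSm using hcell
  have hSmeas : Measurable fun x => S (N x) x :=
    (measurable_from_prod_countable_right (f := fun p : ℕ × X => S p.1 p.2) hS).comp
      (hN.prodMk measurable_id)
  refine ⟨fun x => S (N x) x, hSmeas, ?_⟩
  have hN' : Measurable fun p : X × Y => N p.1 := hN.comp measurable_fst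
  have hm : Measurable fun p : X × Y => (N p.1, p.2) := hN'.prodMk measurable_snd
  ext B hB
  rw [Measure.map_apply (hN.prodMk hSmeas) hB, Measure.map_apply hm hB,
    measure_eq_tsum_fiber μ hN (hN.prodMk hSmeas hB), measure_eq_tsum_fiber γ hN' (hm hB)]
  refine tsum_congr fun n => ?_
  have hBn : MeasurableSet (Prod.mk n ⁻¹' B) := measurable_prodMk_left hB
  have := congrArg (fun m => m (Prod.mk n ⁻¹' B)) (hSm n)
  simp only [Measure.map_apply (hS n) hBn, Measure.map_apply measurable_snd hBn,
    Measure.restrict_apply (hS n hBn), Measure.restrict_apply (measurable_snd hBn)] at this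
  convert this using 2
  · ext x
    simp only [Set.mem_inter_iff, Set.mem_preimage, Set.mem_singleton_iff]
    constructor <;> rintro ⟨h, rfl⟩ <;> exact ⟨h, rfl⟩
  · ext x
    simp only [Set.mem_inter_iff, Set.mem_preimage, Set.mem_singleton_iff]
    constructor <;> rintro ⟨h, rfl⟩ <;> exact ⟨h, rfl⟩

end AtomlessTransport

/-! ### Geometry of transport rays -/

section TransportRays

open scoped RealInnerProductSpace

theorem sub_le_norm_sub_of_lipschitz {V : Type*} [SeminormedAddCommGroup V] {u : V → ℝ}
    (hu : LipschitzWith 1 u) (x y : V) :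
    u x - u y ≤ ‖x - y‖ := by
  have := hu.dist_le_mul x y
  rw [Real.dist_eq, NNReal.coe_one, one_mul, dist_eq_norm] at this
  exact (le_abs_self _).trans this

variable {V : Type*} [NormedAddCommGroup V] [InnerProductSpace ℝ V]

/-- A `1`-Lipschitz function that decreases at full speed from `x` to `y` is affine with slope
`-1` along the segment between them. -/
theorem eq_sub_of_ray {u : V → ℝ} (hu : LipschitzWith 1 u) {x y : V}
    (h : u x - u y = ‖x - y‖) {t : ℝ} (h0 : 0 ≤ t) (h1 : t ≤ ‖x - y‖) :
    u (x - t • (‖x - y‖⁻¹ • (x - y))) = u x - t := by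
  rcases eq_or_ne x y with rfl | hxy
  · have : t = 0 := le_antisymm (by simpa using h1) h0
    simp [this]
  set l := ‖x - y‖ with hl
  have hlpos : 0 < l := norm_pos_iff.2 (sub_ne_zero.2 hxy)
  have hnorm : ‖l⁻¹ • (x - y)‖ = 1 := by
    rw [norm_smul, norm_inv, Real.norm_eq_abs, abs_of_pos hlpos, ← hl, inv_mul_cancel₀ hlpos.ne']
  have e1 : x - (x - t • (l⁻¹ • (x - y))) = t • (l⁻¹ • (x - y)) := by abel
  have e2 : x - t • (l⁻¹ • (x - y)) - y = (l - t) • (l⁻¹ • (x - y)) := by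
    rw [sub_smul, smul_inv_smul₀ hlpos.ne']; abel
  have a1 := sub_le_norm_sub_of_lipschitz hu x (x - t • (l⁻¹ • (x - y)))
  have a2 := sub_le_norm_sub_of_lipschitz hu (x - t • (l⁻¹ • (x - y))) y
  rw [e1, norm_smul, hnorm, Real.norm_eq_abs, abs_of_nonneg h0] at a1
  rw [e2, norm_smul, hnorm, Real.norm_eq_abs, abs_of_nonneg (sub_nonneg.2 h1)] at a2
  linarith

theorem norm_sub_smul_le (h e : V) (he : ‖e‖ = 1) {r : ℝ} (hr : 0 < r) :
    ‖h - r • e‖ ≤ r - ⟪e, h⟫ + ‖h‖ ^ 2 / (2 * r) := by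
  have h1 : ‖h - r • e‖ ^ 2 = ‖h‖ ^ 2 - 2 * (r * ⟪e, h⟫) + r ^ 2 := by
    rw [norm_sub_sq_real, inner_smul_right, norm_smul, he, real_inner_comm, Real.norm_eq_abs,
      mul_one, sq_abs]
  have h2 : r - ⟪e, h⟫ + ‖h‖ ^ 2 / (2 * r) = (‖h - r • e‖ ^ 2 + r ^ 2) / (2 * r) := by
    rw [h1]; field_simp; ring
  rw [h2, le_div_iff₀ (by positivity)]
  nlinarith [sq_nonneg (‖h - r • e‖ - r)]

/-- The interior points of transport rays of `u`, at distance at least `r` from both ends: along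
some unit vector `e`, the function `u` has slope `1` on the segment of half-length `r`. -/
def rayInterior (u : V → ℝ) (r : ℝ) : Set V :=
  {p | ∃ e : V, ‖e‖ = 1 ∧ u (p + r • e) = u p + r ∧ u (p - r • e) = u p - r}

/-- In the middle of a ray, `u` is squeezed between the two cones with apices at the ends of the
ray, hence agrees with its linearization up to a quadratic error. -/
theorem abs_sub_inner_le_of_ray {u : V → ℝ} (hu : LipschitzWith 1 u) {p e : V} {r : ℝ}
    (hr : 0 < r) (he : ‖e‖ = 1) (h1 : u (p + r • e) = u p + r) (h2 : u (p - r • e) = u p - r)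
    (h : V) : |u (p + h) - u p - ⟪e, h⟫| ≤ ‖h‖ ^ 2 / (2 * r) := by
  have a1 := sub_le_norm_sub_of_lipschitz hu (p + r • e) (p + h)
  have a2 := sub_le_norm_sub_of_lipschitz hu (p + h) (p - r • e)
  have e1 : p + r • e - (p + h) = -(h - r • e) := by abel
  have e2 : p + h - (p - r • e) = -(-h - r • e) := by abel
  rw [e1, norm_neg] at a1
  rw [e2, norm_neg] at a2
  have b1 := norm_sub_smul_le h e he hr
  have b2 := norm_sub_smul_le (-h) e he hr
  rw [inner_neg_right, norm_neg] at b2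
  rw [abs_le]
  constructor <;> linarith

theorem hasGradientAt_of_ray [CompleteSpace V] {u : V → ℝ} (hu : LipschitzWith 1 u) {p e : V}
    {r : ℝ} (hr : 0 < r) (he : ‖e‖ = 1) (h1 : u (p + r • e) = u p + r)
    (h2 : u (p - r • e) = u p - r) : HasGradientAt u e p := by
  rw [hasGradientAt_iff_isLittleO_nhds_zero]
  refine Asymptotics.IsBigO.trans_isLittleO (g := fun h : V => ‖h‖ ^ 2) ?_ ?_
  · refine Asymptotics.IsBigO.of_bound (1 / (2 * r)) (Eventually.of_forall fun h => ?_)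
    rw [Real.norm_eq_abs, Real.norm_eq_abs, abs_of_nonneg (sq_nonneg ‖h‖)]
    refine (abs_sub_inner_le_of_ray hu hr he h1 h2 h).trans_eq ?_
    ring
  · exact Asymptotics.isLittleO_norm_pow_id one_lt_two

/-- The directions of transport rays depend Lipschitz continuously on the point, away from the
ends of the rays. -/
theorem norm_sub_le_of_rays [CompleteSpace V] {u : V → ℝ} (hu : LipschitzWith 1 u) {p q e f : V}
    {r : ℝ} (hr : 0 < r) (he : ‖e‖ = 1) (hp1 : u (p + r • e) = u p + r)
    (hp2 : u (p - r • e) = u p - r) (hf : ‖f‖ = 1) (hq1 : u (q + r • f) = u q + r)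
    (hq2 : u (q - r • f) = u q - r) : ‖e - f‖ ≤ 3 / r * ‖p - q‖ := by
  rcases eq_or_ne e f with rfl | hef
  · simp only [sub_self, norm_zero]; positivity
  have hpos : 0 < ‖e - f‖ := norm_pos_iff.2 (sub_ne_zero.2 hef)
  -- Compare the two expansions at `q + w`, with `w` of length `‖p - q‖` in the direction `e - f`.
  set k := ‖p - q‖ with hk
  set w := (k * ‖e - f‖⁻¹) • (e - f) with hw
  have hwn : ‖w‖ = k := by
    rw [hw, norm_smul, norm_mul, norm_inv, norm_norm, hk, norm_norm, mul_assoc,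
      inv_mul_cancel₀ hpos.ne', mul_one]
  have hin : ⟪e, w⟫ - ⟪f, w⟫ = k * ‖e - f‖ := by
    rw [← inner_sub_left, hw, inner_smul_right, real_inner_self_eq_norm_sq]
    field_simp
  have hqp : ‖q - p‖ = k := norm_sub_rev _ _
  have a1 := abs_le.1 (abs_sub_inner_le_of_ray hu hr he hp1 hp2 (q - p + w))
  have a2 := abs_le.1 (abs_sub_inner_le_of_ray hu hr he hp1 hp2 (q - p))
  have a3 := abs_le.1 (abs_sub_inner_le_of_ray hu hr hf hq1 hq2 w)
  rw [show p + (q - p + w) = q + w by abel, inner_add_right] at a1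
  rw [show p + (q - p) = q by abel, hqp] at a2
  rw [hwn] at a3
  have hsum : ‖q - p + w‖ ^ 2 / (2 * r) ≤ (2 * k) ^ 2 / (2 * r) := by
    gcongr
    exact (norm_add_le _ _).trans_eq (by rw [hqp, hwn]; ring)
  have hmain : k * ‖e - f‖ ≤ k * (3 / r * k) := by
    have : (2 * k) ^ 2 / (2 * r) + k ^ 2 / (2 * r) + k ^ 2 / (2 * r) = k * (3 / r * k) := by
      field_simp; ring
    linarith
  rcases (norm_nonneg (p - q)).eq_or_lt with h0 | h0
  · -- For `p = q` both directions are the gradient at that point.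
    have hpq : p = q := sub_eq_zero.1 (norm_eq_zero.1 h0.symm)
    subst hpq
    exact absurd ((hasGradientAt_of_ray hu hr he hp1 hp2).gradient.symm.trans
      (hasGradientAt_of_ray hu hr hf hq1 hq2).gradient) hef
  · exact le_of_mul_le_mul_left hmain h0

theorem isClosed_rayInterior [FiniteDimensional ℝ V] {u : V → ℝ} (hu : Continuous u) (r : ℝ) :
    IsClosed (rayInterior u r) := by
  have hc : IsClosed {z : V × Metric.sphere (0 : V) 1 |
      u (z.1 + r • (z.2 : V)) = u z.1 + r ∧ u (z.1 - r • (z.2 : V)) = u z.1 - r} :=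
    (isClosed_eq (by fun_prop) (by fun_prop)).inter (isClosed_eq (by fun_prop) (by fun_prop))
  have := ProperSpace.of_locallyCompactSpace ℝ (E := V)
  convert isClosedMap_fst_of_compactSpace _ hc
  ext p
  constructor
  · rintro ⟨e, he, h⟩
    exact ⟨(p, ⟨e, by simp [he]⟩), h, rfl⟩
  · rintro ⟨⟨p, e⟩, h, rfl⟩
    exact ⟨e, by simp, h⟩

theorem lipschitzOnWith_gradient_rayInterior [CompleteSpace V] {u : V → ℝ}
    (hu : LipschitzWith 1 u) {r : ℝ} (hr : 0 < r) :
    LipschitzOnWith (3 / r).toNNReal (gradient u) (rayInterior u r) := by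
  refine LipschitzOnWith.of_dist_le_mul fun p hp q hq => ?_
  obtain ⟨e, he, hp1, hp2⟩ := hp
  obtain ⟨f, hf, hq1, hq2⟩ := hq
  rw [(hasGradientAt_of_ray hu hr he hp1 hp2).gradient,
    (hasGradientAt_of_ray hu hr hf hq1 hq2).gradient, dist_eq_norm, dist_eq_norm,
    Real.coe_toNNReal _ (by positivity)]
  exact norm_sub_le_of_rays hu hr he hp1 hp2 hf hq1 hq2

theorem norm_gradient_le_one [CompleteSpace V] {u : V → ℝ} (hu : LipschitzWith 1 u) (x : V) :
    ‖gradient u x‖ ≤ 1 := by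
  rw [gradient, LinearIsometryEquiv.norm_map]
  simpa using norm_fderiv_le_of_lipschitz ℝ hu (x₀ := x)

/-- At a point of differentiability, the gradient points along the transport ray. -/
theorem gradient_eq_of_ray [CompleteSpace V] {u : V → ℝ} (hu : LipschitzWith 1 u) {x y : V}
    (hd : DifferentiableAt ℝ u x) (hxy : x ≠ y) (h : u x - u y = ‖x - y‖) :
    gradient u x = ‖x - y‖⁻¹ • (x - y) := by
  have hlpos : 0 < ‖x - y‖ := norm_pos_iff.2 (sub_ne_zero.2 hxy)
  set e := ‖x - y‖⁻¹ • (x - y) with he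
  have hnorm : ‖e‖ = 1 := by
    rw [he, norm_smul, norm_inv, norm_norm, inv_mul_cancel₀ hlpos.ne']
  have hd1 : HasDerivAt (fun t : ℝ => x - t • e) (-e) 0 := by
    simpa using ((hasDerivAt_id (0 : ℝ)).smul_const e).const_sub x
  have hd2 : HasDerivAt (fun t : ℝ => u (x - t • e)) (fderiv ℝ u x (-e)) 0 := by
    refine HasFDerivAt.comp_hasDerivAt (0 : ℝ) ?_ hd1
    simpa using hd.hasFDerivAt
  have hd3 : HasDerivWithinAt (fun t : ℝ => u (x - t • e)) (-1) (Set.Icc 0 ‖x - y‖) 0 := by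
    refine HasDerivWithinAt.congr (f := fun t => u x - t) ?_
      (fun t ht => eq_sub_of_ray hu h ht.1 ht.2) (eq_sub_of_ray hu h le_rfl hlpos.le)
    exact ((hasDerivAt_id (0 : ℝ)).const_sub (u x)).hasDerivWithinAt
  have huniq : fderiv ℝ u x (-e) = -1 :=
    (uniqueDiffOn_Icc hlpos 0 ⟨le_rfl, hlpos.le⟩).eq_deriv _ hd2.hasDerivWithinAt hd3
  have hin : ⟪gradient u x, e⟫ = 1 := by
    have : fderiv ℝ u x e = 1 := by rw [map_neg] at huniq; linarith
    rw [gradient, InnerProductSpace.toDual_symm_apply, this]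
  have hsq : ‖gradient u x - e‖ ^ 2 ≤ 0 := by
    rw [norm_sub_sq_real, hin, hnorm]
    have := norm_gradient_le_one hu x
    nlinarith [norm_nonneg (gradient u x)]
  exact sub_eq_zero.1 (norm_eq_zero.1 (by nlinarith [norm_nonneg (gradient u x - e)]))

end TransportRays

/-! ### Change of variables along a Lipschitz left inverse -/

section ChangeOfVariables

/-- If `g` agrees near `y` with a differentiable `h` on a set whose complement has density `0` at
`y`, then the derivative of `h` is the approximate derivative of `g`. -/
theorem hasApproxFDerivAt_of_eqOn {d : ℕ} {g h : E d → E d} {y : E d} {B U : Set (E d)}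
    (hh : DifferentiableAt ℝ h y) (hU : U ∈ 𝓝 y) (hy : y ∈ B) (hgh : Set.EqOn g h (B ∩ U))
    (hB : Tendsto (fun r : ℝ => volume (Bᶜ ∩ Metric.closedBall y r) /
      volume (Metric.closedBall y r)) (𝓝[>] 0) (𝓝 0)) :
    HasApproxFDerivAt g (fderiv ℝ h y) y := by
  intro ε hε
  refine tendsto_of_tendsto_of_tendsto_of_le_of_le' tendsto_const_nhds hB
    (Eventually.of_forall fun _ => zero_le) ?_
  have h1 : ∀ᶠ z in 𝓝 y, z ∈ U ∧ ‖h z - h y - fderiv ℝ h y (z - y)‖ ≤ ε * ‖z - y‖ :=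
    Filter.Eventually.and hU (hh.hasFDerivAt.isLittleO.def hε)
  obtain ⟨δ, hδ, hball⟩ := Metric.eventually_nhds_iff_ball.1 h1
  filter_upwards [Ioo_mem_nhdsGT hδ] with r hr
  refine ENNReal.div_le_div_right (measure_mono ?_) _
  refine fun z hz => ⟨fun hzB => ?_, hz.2⟩
  obtain ⟨hzU, hle⟩ := hball z (Metric.closedBall_subset_ball hr.2 hz.2)
  have hz1 : ε * ‖z - y‖ < ‖g z - g y - fderiv ℝ h y (z - y)‖ := hz.1
  rw [hgh ⟨hzB, hzU⟩, hgh ⟨hy, mem_of_mem_nhds hU⟩] at hz1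
  exact hz1.not_ge hle

variable {V : Type*} [NormedAddCommGroup V] [NormedSpace ℝ V] [FiniteDimensional ℝ V]
  [MeasurableSpace V] [BorelSpace V] {m : Measure V} [m.IsAddHaarMeasure]

open scoped Measure in
theorem addHaar_image_eq_zero_of_lipschitzWith {h : V → V} {C : ℝ≥0} (hh : LipschitzWith C h)
    {N : Set V} (hN : m N = 0) : m (h '' N) = 0 := by
  have h1 := hh.hausdorffMeasure_image_le (d := Module.finrank ℝ V) (by positivity) N
  have h2 : μH[Module.finrank ℝ V] N = 0 :=
    Measure.absolutelyContinuous_isAddHaarMeasure μH[Module.finrank ℝ V] m hN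
  rw [h2, mul_zero, nonpos_iff_eq_zero] at h1
  exact Measure.absolutelyContinuous_isAddHaarMeasure m μH[Module.finrank ℝ V] h1

variable {F G h : V → V} {C : ℝ≥0} {B : Set V} {μ : Measure V}

/-- The preimage of a null set under `F` is contained, up to a null set, in its image under the
Lipschitz map `h`. -/
theorem map_absolutelyContinuous_of_lipschitz_leftInverse (hF : Measurable F)
    (hh : LipschitzWith C h) (hGh : Set.EqOn G h B) (hμ : μ ≪ m)
    (hinv : ∀ᵐ x ∂μ, F x ∈ B ∧ G (F x) = x) : μ.map F ≪ m := by
  refine Measure.AbsolutelyContinuous.mk fun N hN hN0 => ?_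
  rw [Measure.map_apply hF hN]
  have h0 : μ (h '' N) = 0 := hμ (addHaar_image_eq_zero_of_lipschitzWith hh hN0)
  refine measure_mono_null_ae ?_ h0
  filter_upwards [hinv] with x hx hxN
  exact ⟨F x, hxN, by rw [← hGh hx.1, hx.2]⟩

/-- Let `F` transport the density `ρ` to the density `ρ₁`, and let the left inverse `G` of `F`
coincide with a Lipschitz map `h` on `B`. Then the Jacobian equation holds almost everywhere. -/
theorem density_map_eq_mul_abs_det (hF : Measurable F) (hG : Measurable G)
    (hh : LipschitzWith C h) (hB : MeasurableSet B) (hGh : Set.EqOn G h B)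
    (hinv : ∀ᵐ x ∂μ, F x ∈ B ∧ G (F x) = x) {ρ ρ₁ : V → ℝ≥0∞} (hρ : Measurable ρ)
    (hρ₁ : Measurable ρ₁) (hμ : μ = m.withDensity ρ) (hμ₁ : μ.map F = m.withDensity ρ₁)
    [IsFiniteMeasure μ] :
    ∀ᵐ x ∂μ, ρ₁ (F x) = ρ x * ENNReal.ofReal |(fderiv ℝ h (F x)).det| := by
  have hac : μ ≪ m := hμ ▸ withDensity_absolutelyContinuous m ρ
  have hac₁ : μ.map F ≪ m :=
    map_absolutelyContinuous_of_lipschitz_leftInverse hF hh hGh hac hinv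
  -- The part of `B` on which `G` is injective, with inverse `F`, and `h` is differentiable.
  set B' : Set V := (B ∩ {y | F (G y) = y}) ∩ {y | DifferentiableAt ℝ h y} with hB'
  have hB'm : MeasurableSet B' :=
    (hB.inter (measurableSet_eq_fun (hF.comp hG) measurable_id)).inter
      (measurableSet_of_differentiableAt ℝ h)
  have hdiff : ∀ᵐ x ∂μ, DifferentiableAt ℝ h (F x) :=
    ae_of_ae_map hF.aemeasurable (hac₁.ae_le hh.ae_differentiableAt)
  have hmem : ∀ᵐ x ∂μ, F x ∈ B' := by
    filter_upwards [hinv, hdiff] with x hx hxd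
    exact ⟨⟨hx.1, by simp only [Set.mem_ofPred_eq, hx.2]⟩, hxd⟩
  have hGB : ∀ N ⊆ B', Set.InjOn h N := by
    intro N hN y hy z hz hyz
    rw [← hGh (hN hy).1.1, ← hGh (hN hz).1.1] at hyz
    rw [← (hN hy).1.2, ← (hN hz).1.2, hyz]
  have hdetm : Measurable fun y => ENNReal.ofReal |(fderiv ℝ h y).det| :=
    ENNReal.measurable_ofReal.comp
      ((ContinuousLinearMap.continuous_det.measurable.comp (measurable_fderiv ℝ h)).abs)
  have heq : ρ₁ =ᵐ[m.restrict B'] fun y => ENNReal.ofReal |(fderiv ℝ h y).det| * ρ (G y) := by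
    refine ae_eq_of_forall_setLIntegral_eq_of_sigmaFinite hρ₁ (hdetm.mul (hρ.comp hG))
      fun N hN _ => ?_
    rw [Measure.restrict_restrict hN]
    have hNB : N ∩ B' ⊆ B' := Set.inter_subset_right
    have hNm : MeasurableSet (N ∩ B') := hN.inter hB'm
    have h1 : ∫⁻ y in N ∩ B', ρ₁ y ∂m = μ (F ⁻¹' (N ∩ B')) := by
      rw [← withDensity_apply _ hNm, ← hμ₁, Measure.map_apply hF hNm]
    have h2 : μ (F ⁻¹' (N ∩ B')) = μ (h '' (N ∩ B')) := by
      refine measure_congr ?_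
      filter_upwards [hinv] with x hx
      refine propext ⟨fun hxN => ⟨F x, hxN, by rw [← hGh hx.1, hx.2]⟩, ?_⟩
      rintro ⟨y, hy, rfl⟩
      have : F (h y) = y := by rw [← hGh (hNB hy).1.1]; exact (hNB hy).1.2
      change F (h y) ∈ N ∩ B'
      rwa [this]
    rw [h1, h2, hμ, withDensity_apply' _ _, lintegral_image_eq_lintegral_abs_det_fderiv_mul m hNm
      (fun y hy => (hNB hy).2.hasFDerivAt.hasFDerivWithinAt) (hGB _ hNB)]
    refine setLIntegral_congr_fun hNm fun y hy => ?_
    simp only [hGh (hNB hy).1.1]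
  have heq' : ∀ᵐ y ∂μ.map F, y ∈ B' → ρ₁ y = ENNReal.ofReal |(fderiv ℝ h y).det| * ρ (G y) :=
    hac₁.ae_le ((ae_restrict_iff' hB'm).1 heq)
  filter_upwards [hinv, hmem, ae_of_ae_map hF.aemeasurable heq'] with x hx hxB hx1
  rw [hx1 hxB, hx.2, mul_comm]

end ChangeOfVariables

/-! ### The Kantorovich and Monge problems on a compact set -/

section KantorovichProblem

variable {d : ℕ} {Ω : Set (E d)} {μ ν : Measure (E d)}

theorem IsProbOn.ae_mem (hμ : IsProbOn Ω μ) : ∀ᵐ x ∂μ, x ∈ Ω := hμ.2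

theorem IsProbOn.restrict_eq (hμ : IsProbOn Ω μ) : μ.restrict Ω = μ :=
  Measure.restrict_eq_self_of_ae_mem hμ.ae_mem

theorem IsProbOn.integrable (hΩ : IsCompact Ω) (hμ : IsProbOn Ω μ) {v : E d → ℝ}
    (hv : ContinuousOn v Ω) : Integrable v μ := by
  have := hμ.1
  rw [← hμ.restrict_eq]
  exact hv.integrableOn_compact' hΩ hΩ.measurableSet

theorem isProbOn_map {F : E d → E d} (hμ : IsProbOn Ω μ) (hΩ : IsCompact Ω)
    (hF : AEMeasurable F μ) (h : ∀ᵐ x ∂μ, F x ∈ Ω) : IsProbOn Ω (μ.map F) := by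
  have := hμ.1
  refine ⟨Measure.isProbabilityMeasure_map hF, ?_⟩
  rw [Measure.map_apply_of_aemeasurable hF hΩ.measurableSet.compl]
  exact h

theorem ofReal_integral_le_lintegral_ofReal {Z : Type*} [MeasurableSpace Z] {m : Measure Z}
    {f : Z → ℝ} (hf : Integrable f m) :
    ENNReal.ofReal (∫ z, f z ∂m) ≤ ∫⁻ z, ENNReal.ofReal (f z) ∂m := by
  rw [integral_eq_lintegral_pos_part_sub_lintegral_neg_part hf]
  refine (ENNReal.ofReal_le_ofReal (sub_le_self _ ENNReal.toReal_nonneg)).trans ?_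
  exact ENNReal.ofReal_toReal_le

/-- Weak duality: the dual value of a `1`-Lipschitz function is at most the cost of a plan. -/
theorem ofReal_dual_le_lintegral (hΩ : IsCompact Ω) (hμ : IsProbOn Ω μ) (hν : IsProbOn Ω ν)
    {v : E d → ℝ} (hv : LipschitzOnWith 1 v Ω) {γ : Measure (E d × E d)}
    (hγ : γ ∈ admissiblePlans μ ν) :
    ENNReal.ofReal (∫ x, v x ∂μ - ∫ y, v y ∂ν) ≤ ∫⁻ p, edist p.1 p.2 ∂γ := by
  obtain ⟨h1, h2⟩ := hγ
  have i1 : Integrable v (γ.map Prod.fst) := h1 ▸ hμ.integrable hΩ hv.continuousOn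
  have i2 : Integrable v (γ.map Prod.snd) := h2 ▸ hν.integrable hΩ hv.continuousOn
  have j1 : Integrable (fun p : E d × E d => v p.1) γ := i1.comp_measurable measurable_fst
  have j2 : Integrable (fun p : E d × E d => v p.2) γ := i2.comp_measurable measurable_snd
  have e1 : ∫ x, v x ∂μ = ∫ p, v p.1 ∂γ := by
    rw [← h1, integral_map measurable_fst.aemeasurable i1.aestronglyMeasurable]
  have e2 : ∫ x, v x ∂ν = ∫ p, v p.2 ∂γ := by
    rw [← h2, integral_map measurable_snd.aemeasurable i2.aestronglyMeasurable]
  rw [e1, e2, ← integral_sub j1 j2]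
  refine (ofReal_integral_le_lintegral_ofReal (j1.sub j2)).trans (lintegral_mono_ae ?_)
  have m1 : ∀ᵐ p ∂γ, p.1 ∈ Ω :=
    ae_of_ae_map measurable_fst.aemeasurable (h1.symm ▸ hμ.ae_mem)
  have m2 : ∀ᵐ p ∂γ, p.2 ∈ Ω :=
    ae_of_ae_map measurable_snd.aemeasurable (h2.symm ▸ hν.ae_mem)
  filter_upwards [m1, m2] with p hp1 hp2
  rw [edist_dist]
  refine ENNReal.ofReal_le_ofReal ?_
  have := hv.dist_le_mul _ hp1 _ hp2
  rw [NNReal.coe_one, one_mul, Real.dist_eq] at this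
  exact (le_abs_self _).trans this

/-- Duality for measures on a compact set of `ℝ^d`. -/
theorem exists_admissiblePlan_le_dual (hΩ : IsCompact Ω) (hμ : IsProbOn Ω μ) (hν : IsProbOn Ω ν)
    {D : ℝ} (hD : ∀ v : E d → ℝ, LipschitzOnWith 1 v Ω → ∫ x, v x ∂μ - ∫ y, v y ∂ν ≤ D) :
    ∃ γ ∈ admissiblePlans μ ν, ∫⁻ p, edist p.1 p.2 ∂γ ≤ ENNReal.ofReal D := by
  have := isCompact_iff_compactSpace.1 hΩ
  have hemb : MeasurableEmbedding (Subtype.val : Ω → E d) :=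
    MeasurableEmbedding.subtype_coe hΩ.measurableSet
  have hmap {m : Measure (E d)} (hm : IsProbOn Ω m) :
      (m.comap (Subtype.val : Ω → E d)).map Subtype.val = m := by
    rw [map_comap_subtype_coe hΩ.measurableSet, hm.restrict_eq]
  have hprob {m : Measure (E d)} (hm : IsProbOn Ω m) :
      IsProbabilityMeasure (m.comap (Subtype.val : Ω → E d)) := by
    have := hm.1
    refine ⟨?_⟩
    have h1 := congrArg (fun k => k Set.univ) (hmap hm)
    simpa [Measure.map_apply measurable_subtype_coe] using h1
  have := hprob hμ
  have := hprob hν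
  have hD' (v : Ω → ℝ) (hv : LipschitzWith 1 v) :
      ∫ x, v x ∂(μ.comap (Subtype.val : Ω → E d)) - ∫ x, v x ∂(ν.comap (Subtype.val : Ω → E d)) ≤
        D := by
    have hext (x : Ω) : Function.extend Subtype.val v 0 (x : E d) = v x :=
      Subtype.val_injective.extend_apply v 0 x
    have hl : LipschitzOnWith 1 (Function.extend Subtype.val v (0 : E d → ℝ)) Ω := by
      intro x hx y hy
      have := hv ⟨x, hx⟩ ⟨y, hy⟩
      rwa [← hext ⟨x, hx⟩, ← hext ⟨y, hy⟩] at this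
    have := hD _ hl
    rw [← hmap hμ, ← hmap hν, hemb.integral_map, hemb.integral_map] at this
    simpa only [hext, hmap hμ, hmap hν] using this
  obtain ⟨γ, h1, h2, h3⟩ := exists_plan_le_dual hD'
  have hpm : Measurable (Prod.map Subtype.val Subtype.val : Ω × Ω → E d × E d) :=
    measurable_subtype_coe.prodMap measurable_subtype_coe
  refine ⟨γ.map (Prod.map Subtype.val Subtype.val), ⟨?_, ?_⟩, ?_⟩
  · rw [Measure.map_map measurable_fst hpm, Prod.map_fst',
      ← Measure.map_map measurable_subtype_coe measurable_fst, h1, hmap hμ]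
  · rw [Measure.map_map measurable_snd hpm, Prod.map_snd',
      ← Measure.map_map measurable_subtype_coe measurable_snd, h2, hmap hν]
  · rw [lintegral_map (by fun_prop) hpm]
    exact h3

/-- For an atomless first marginal, the cost of a plan can be approximated by that of maps. -/
theorem exists_map_lintegral_le_add [NullSingletonClass μ] [IsFiniteMeasure μ]
    {γ : Measure (E d × E d)} (hγ : γ ∈ admissiblePlans μ ν) {ε : ℝ} (hε : 0 < ε) :
    ∃ S : E d → E d, Measurable S ∧ μ.map S = ν ∧
      ∫⁻ x, edist x (S x) ∂μ ≤ ∫⁻ p, edist p.1 p.2 ∂γ + 2 * (ENNReal.ofReal ε * μ Set.univ) := by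
  obtain ⟨h1, h2⟩ := hγ
  have huniv : γ Set.univ = μ Set.univ := by
    rw [← h1, Measure.map_apply measurable_fst MeasurableSet.univ, Set.preimage_univ]
  have : IsFiniteMeasure γ := ⟨huniv ▸ measure_lt_top μ _⟩
  -- Cells of radius `ε` around the points of a dense sequence.
  have hex (x : E d) : ∃ n, dist x (TopologicalSpace.denseSeq (E d) n) < ε :=
    (TopologicalSpace.denseRange_denseSeq (E d)).exists_dist_lt x hε
  classical
  set c := TopologicalSpace.denseSeq (E d)
  have hN : Measurable fun x => Nat.find (hex x) :=
    measurable_find hex fun n => measurableSet_lt (by fun_prop) measurable_const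
  have hNc (x : E d) : edist x (c (Nat.find (hex x))) ≤ ENNReal.ofReal ε := by
    rw [edist_dist]
    exact ENNReal.ofReal_le_ofReal (Nat.find_spec (hex x)).le
  obtain ⟨S, hS, hSm⟩ := exists_measurable_map_eq_of_countable_partition h1 hN
  have hm : Measurable fun p : E d × E d => (Nat.find (hex p.1), p.2) :=
    (hN.comp measurable_fst).prodMk measurable_snd
  have hk : Measurable fun q : ℕ × E d => edist (c q.1) q.2 :=
    (measurable_from_nat (f := c).comp measurable_fst).edist measurable_snd
  refine ⟨S, hS, ?_, ?_⟩
  · have := congrArg (fun m => m.map Prod.snd) hSm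
    simp only [Measure.map_map measurable_snd (hN.prodMk hS), Measure.map_map measurable_snd hm]
      at this
    exact this.trans h2
  · have hcost : ∫⁻ x, edist (c (Nat.find (hex x))) (S x) ∂μ =
        ∫⁻ p, edist (c (Nat.find (hex p.1))) p.2 ∂γ := by
      rw [← lintegral_map hk (hN.prodMk hS), hSm, lintegral_map hk hm]
    calc ∫⁻ x, edist x (S x) ∂μ
        ≤ ∫⁻ x, (edist (c (Nat.find (hex x))) (S x) + ENNReal.ofReal ε) ∂μ := by
          refine lintegral_mono fun x => ?_
          rw [add_comm]
          exact (edist_triangle _ _ _).trans (by gcongr; exact hNc x)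
      _ = ∫⁻ p, edist (c (Nat.find (hex p.1))) p.2 ∂γ + ENNReal.ofReal ε * μ Set.univ := by
          rw [lintegral_add_right _ measurable_const, hcost, lintegral_const]
      _ ≤ ∫⁻ p, (edist p.1 p.2 + ENNReal.ofReal ε) ∂γ + ENNReal.ofReal ε * μ Set.univ := by
          gcongr with p
          rw [add_comm]
          refine (edist_triangle _ p.1 _).trans ?_
          gcongr
          rw [edist_comm]
          exact hNc p.1
      _ = _ := by
          rw [lintegral_add_right _ measurable_const, lintegral_const, huniv, two_mul, add_assoc]

/-- An optimal map for an atomless first marginal is optimal among plans. -/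
theorem IsOptimalMap.lintegral_le [NullSingletonClass μ] [IsProbabilityMeasure μ]
    {T : E d → E d} (hT : IsOptimalMap μ ν T) {γ : Measure (E d × E d)}
    (hγ : γ ∈ admissiblePlans μ ν) :
    ∫⁻ x, edist x (T x) ∂μ ≤ ∫⁻ p, edist p.1 p.2 ∂γ := by
  refine ENNReal.le_of_forall_pos_le_add fun ε hε _ => ?_
  obtain ⟨S, hS, hSν, hle⟩ := exists_map_lintegral_le_add hγ (ε := ε / 2) (by positivity)
  refine (hT.le S hS.aemeasurable hSν).trans (hle.trans_eq ?_)
  rw [measure_univ, mul_one, two_mul, ← ENNReal.ofReal_add (by positivity) (by positivity),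
    add_halves, ENNReal.ofReal_coe_nnreal]

theorem map_prodMk_mem_admissiblePlans {T : E d → E d} (hT : AEMeasurable T μ)
    (hTν : μ.map T = ν) : μ.map (fun x => (x, T x)) ∈ admissiblePlans μ ν := by
  have h : AEMeasurable (fun x => (x, T x)) μ := aemeasurable_id.prodMk hT
  refine ⟨?_, ?_⟩
  · rw [AEMeasurable.map_map_of_aemeasurable measurable_fst.aemeasurable h]
    exact Measure.map_id
  · rw [AEMeasurable.map_map_of_aemeasurable measurable_snd.aemeasurable h]
    exact hTν

theorem lintegral_map_prodMk {T : E d → E d} (hT : AEMeasurable T μ) :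
    ∫⁻ p, edist p.1 p.2 ∂(μ.map fun x => (x, T x)) = ∫⁻ x, edist x (T x) ∂μ :=
  lintegral_map' (by fun_prop) (aemeasurable_id.prodMk hT)

/-- A transport map whose cost is at most the dual value of `u` certifies that it is optimal, that
`u` is a Kantorovich potential and that the Wasserstein distance is that value. -/
theorem optimality_of_lintegral_le_dual (hΩ : IsCompact Ω) (hμ : IsProbOn Ω μ)
    (hν : IsProbOn Ω ν) {u : E d → ℝ} (hu : LipschitzOnWith 1 u Ω) {T : E d → E d}
    (hT : AEMeasurable T μ) (hTν : μ.map T = ν)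
    (hle : ∫⁻ x, edist x (T x) ∂μ ≤ ENNReal.ofReal (∫ x, u x ∂μ - ∫ y, u y ∂ν)) :
    IsKantorovichPotential Ω μ ν u ∧ IsOptimalMap μ ν T ∧
      W1 μ ν = ENNReal.ofReal (∫ x, u x ∂μ - ∫ y, u y ∂ν) ∧
      0 ≤ ∫ x, u x ∂μ - ∫ y, u y ∂ν := by
  set D := ∫ x, u x ∂μ - ∫ y, u y ∂ν with hD
  have hplan := map_prodMk_mem_admissiblePlans hT hTν
  have hcost := lintegral_map_prodMk hT
  have hD0 : 0 ≤ D := by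
    by_contra! h
    have h1 := ofReal_dual_le_lintegral hΩ hμ hν (v := fun x => -u x) hu.neg hplan
    rw [hcost] at h1
    rw [integral_neg, integral_neg, ← neg_sub', ← hD] at h1
    have h2 := h1.trans hle
    rw [ENNReal.ofReal_of_nonpos h.le, nonpos_iff_eq_zero, ENNReal.ofReal_eq_zero] at h2
    linarith
  refine ⟨⟨hu, fun v hv => ?_⟩, ⟨hT, hTν, fun S hS hSν => ?_⟩, ?_, hD0⟩
  · rw [← ENNReal.ofReal_le_ofReal_iff hD0]
    exact (ofReal_dual_le_lintegral hΩ hμ hν hv hplan).trans (hcost.trans_le hle)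
  · rw [← lintegral_map_prodMk hS]
    exact hle.trans (ofReal_dual_le_lintegral hΩ hμ hν hu (map_prodMk_mem_admissiblePlans hS hSν))
  · refine le_antisymm ?_ ?_
    · exact (iInf₂_le _ hplan).trans (hcost.trans_le hle)
    · exact le_iInf₂ fun γ hγ => ofReal_dual_le_lintegral hΩ hμ hν hu hγ

/-- The value of the Kantorovich problem is attained by the dual value of a potential. -/
theorem IsKantorovichPotential.lintegral_optimalMap_le (hΩ : IsCompact Ω) (hμ : IsProbOn Ω μ)
    (hν : IsProbOn Ω ν) [NullSingletonClass μ] {u : E d → ℝ}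
    (hu : IsKantorovichPotential Ω μ ν u) {T : E d → E d} (hT : IsOptimalMap μ ν T) :
    ∫⁻ x, edist x (T x) ∂μ ≤ ENNReal.ofReal (∫ x, u x ∂μ - ∫ y, u y ∂ν) := by
  have := hμ.1
  obtain ⟨γ, hγ, hle⟩ := exists_admissiblePlan_le_dual hΩ hμ hν hu.le
  exact (hT.lintegral_le hγ).trans hle

end KantorovichProblem

/-! ### Moving along the transport rays -/

section RayDescent

variable {V : Type*} [NormedAddCommGroup V] [InnerProductSpace ℝ V] [CompleteSpace V]

/-- Moving a point `x` of differentiability along its transport ray towards `y` by `η < ‖x - y‖`: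
the direction is minus the gradient, `u` drops by `η`, the remaining distance drops by `η`, the
gradient stays the same, so that the motion can be undone, and the new point lies inside the ray. -/
theorem descent_along_ray {u : V → ℝ} (hu : LipschitzWith 1 u) {x y : V}
    (hd : DifferentiableAt ℝ u x) (h : u x - u y = ‖x - y‖) {η : ℝ} (h0 : 0 ≤ η)
    (hlt : η < ‖x - y‖) :
    u (x - η • gradient u x) = u x - η ∧
    ‖x - η • gradient u x - y‖ = ‖x - y‖ - η ∧
    x - η • gradient u x = y + (1 - η / ‖x - y‖) • (x - y) ∧
    (∀ r, 0 < r → r ≤ η → r ≤ ‖x - y‖ - η → x - η • gradient u x ∈ rayInterior u r) ∧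
    gradient u (x - η • gradient u x) = gradient u x := by
  have hl : 0 < ‖x - y‖ := h0.trans_lt hlt
  have hxy : x ≠ y := fun hxy => by simp [hxy] at hl
  have hgrad := gradient_eq_of_ray hu hd hxy h
  have hval {t : ℝ} (ht0 : 0 ≤ t) (ht1 : t ≤ ‖x - y‖) : u (x - t • gradient u x) = u x - t := by
    rw [hgrad]
    exact eq_sub_of_ray hu h ht0 ht1
  have hnorm : ‖gradient u x‖ = 1 := by
    rw [hgrad, norm_smul, norm_inv, norm_norm, inv_mul_cancel₀ hl.ne']
  have hexp : x - η • gradient u x = y + (1 - η / ‖x - y‖) • (x - y) := by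
    rw [hgrad, smul_smul, sub_smul, one_smul, div_eq_mul_inv]
    abel
  have hray (r : ℝ) (hr0 : 0 < r) (hr1 : r ≤ η) (hr2 : r ≤ ‖x - y‖ - η) :
      u (x - η • gradient u x + r • gradient u x) = u (x - η • gradient u x) + r ∧
      u (x - η • gradient u x - r • gradient u x) = u (x - η • gradient u x) - r := by
    have e1 : x - η • gradient u x + r • gradient u x = x - (η - r) • gradient u x := by
      rw [sub_smul]; abel
    have e2 : x - η • gradient u x - r • gradient u x = x - (η + r) • gradient u x := by
      rw [add_smul]; abel
    rw [e1, e2, hval (t := η - r) (by linarith) (by linarith),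
      hval (t := η + r) (by linarith) (by linarith)]
    constructor <;> linarith [hval h0 hlt.le]
  refine ⟨hval h0 hlt.le, ?_, hexp, fun r hr0 hr1 hr2 => ⟨_, hnorm, hray r hr0 hr1 hr2⟩, ?_⟩
  · have h1 : 0 ≤ 1 - η / ‖x - y‖ := sub_nonneg.2 ((div_le_one hl).2 hlt.le)
    rw [hexp, add_sub_cancel_left, norm_smul, Real.norm_eq_abs, abs_of_nonneg h1]
    field_simp
  · rcases h0.eq_or_lt with rfl | h0
    · simp
    · have hr0 : 0 < min η (‖x - y‖ - η) := lt_min h0 (sub_pos.2 hlt)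
      obtain ⟨a1, a2⟩ := hray _ hr0 (min_le_left _ _) (min_le_right _ _)
      exact (hasGradientAt_of_ray hu hr0 hnorm a1 a2).gradient

end RayDescent

section DescentMap

variable {d : ℕ} {Ω : Set (E d)} {u₀ u : E d → ℝ} {x : E d}

/-- In the interior of `Ω`, the gradient relative to `Ω` is that of any extension. -/
theorem gradientWithin_eq_gradient_of_mem_interior (h : Set.EqOn u₀ u Ω) (hx : x ∈ interior Ω) :
    (DifferentiableWithinAt ℝ u₀ Ω x ↔ DifferentiableAt ℝ u x) ∧
      gradientWithin u₀ Ω x = gradient u x := by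
  have hn : Ω ∈ 𝓝 x := mem_interior_iff_mem_nhds.1 hx
  have he : u₀ =ᶠ[𝓝 x] u := h.eventuallyEq_of_mem hn
  refine ⟨⟨fun hd => he.differentiableAt_iff.1 (hd.differentiableAt hn),
    fun hd => (he.differentiableAt_iff.2 hd).differentiableWithinAt⟩, ?_⟩
  rw [gradientWithin, gradient, fderivWithin_of_mem_nhds hn, he.fderiv_eq]

/-- In the interior of `Ω` no case distinction is needed: the gradient of `u` is `0` by convention
where `u` is not differentiable. -/
theorem descentMap_eq (h : Set.EqOn u₀ u Ω) (hx : x ∈ interior Ω) (η : ℝ) :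
    descentMap Ω u₀ η x = x - η • gradient u x := by
  obtain ⟨h1, h2⟩ := gradientWithin_eq_gradient_of_mem_interior h hx
  rw [descentMap, h1, h2]
  split_ifs with hd
  · rfl
  · have : ¬ DifferentiableAt ℝ u x := fun hd' => hd ⟨interior_subset hx, hd'⟩
    rw [gradient, fderiv_zero_of_not_differentiableAt this]
    simp

theorem ascentMap_eq (h : Set.EqOn u₀ u Ω) (hx : x ∈ interior Ω) (η : ℝ) :
    ascentMap Ω u₀ η x = x + η • gradient u x := by
  obtain ⟨h1, h2⟩ := gradientWithin_eq_gradient_of_mem_interior h hx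
  rw [ascentMap, h1, h2]
  split_ifs with hd
  · rfl
  · have : ¬ DifferentiableAt ℝ u x := fun hd' => hd ⟨interior_subset hx, hd'⟩
    rw [gradient, fderiv_zero_of_not_differentiableAt this]
    simp

theorem measurable_gradient (u : E d → ℝ) : Measurable (gradient u) :=
  (InnerProductSpace.toDual ℝ (E d)).symm.continuous.measurable.comp (measurable_fderiv ℝ u)

end DescentMap

section Marginals

variable {d : ℕ} {Ω : Set (E d)} {μ ν : Measure (E d)} {T : E d → E d}

theorem ae_map_of_ae_nullMeasurable {X Y : Type*} [MeasurableSpace X] [MeasurableSpace Y]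
    {m : Measure X} {F : X → Y} (hF : AEMeasurable F m) {p : Y → Prop}
    (hp : NullMeasurableSet {y | p y} (m.map F)) (h : ∀ᵐ x ∂m, p (F x)) :
    ∀ᵐ y ∂m.map F, p y := by
  have : m.map F {y | p y}ᶜ = 0 := by
    rw [Measure.map_apply₀ hF hp.compl]
    exact h
  exact this

theorem IsProbOn.ae_mem_interior (hμ : IsProbOn Ω μ) (hΩc : Convex ℝ Ω)
    (hac : μ ≪ volume) : ∀ᵐ x ∂μ, x ∈ interior Ω := by
  have h1 : μ (frontier Ω) = 0 := hac (hΩc.addHaar_frontier volume)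
  filter_upwards [hμ.ae_mem, measure_eq_zero_iff_ae_notMem.1 h1] with x hx hxf
  by_contra hxi
  exact hxf ⟨subset_closure hx, hxi⟩

theorem ae_minTransportLength_le (μ : Measure (E d)) (T : E d → E d) :
    ∀ᵐ x ∂μ, minTransportLength μ T ≤ ‖x - T x‖ :=
  ae_essInf_le ⟨0, eventually_map.2 (Eventually.of_forall fun x => norm_nonneg (x - T x))⟩

theorem le_minTransportLength (hμ : IsProbOn Ω μ) (hΩ : IsCompact Ω) (hT : ∀ᵐ x ∂μ, T x ∈ Ω)
    {c : ℝ} (h : ∀ᵐ x ∂μ, c ≤ ‖x - T x‖) : c ≤ minTransportLength μ T := by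
  have := hμ.1
  refine le_essInf_of_ae_le c h ?_
  refine IsBoundedUnder.isCoboundedUnder_ge ⟨Metric.diam Ω, ?_⟩
  rw [eventually_map]
  filter_upwards [hμ.ae_mem, hT] with x hx hTx
  rw [← dist_eq_norm]
  exact Metric.dist_le_diam_of_mem hΩ.isBounded hx hTx

/-- In dimension `0` no point can be moved. -/
theorem nontrivial_of_minTransportLength_pos [IsProbabilityMeasure μ]
    (h : 0 < minTransportLength μ T) : Nontrivial (E d) := by
  by_contra hn
  have := not_nontrivial_iff_subsingleton.1 hn
  have h0 : (fun x => ‖x - T x‖) = fun _ => (0 : ℝ) := by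
    funext x
    rw [Subsingleton.elim (T x) x, sub_self, norm_zero]
  rw [minTransportLength, h0, essInf_const _ (NeZero.ne μ)] at h
  exact lt_irrefl _ h

/-- Complementary slackness: if the cost of `T` is at most the dual value of `u`, then almost every
point is joined to its image by a transport ray of `u`. -/
theorem ae_sub_eq_norm_sub (hΩ : IsCompact Ω) (hμ : IsProbOn Ω μ) (hν : IsProbOn Ω ν)
    {u : E d → ℝ} (hu : LipschitzWith 1 u) (hT : AEMeasurable T μ) (hTν : μ.map T = ν)
    (hle : ∫⁻ x, edist x (T x) ∂μ ≤ ENNReal.ofReal (∫ x, u x ∂μ - ∫ y, u y ∂ν))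
    (h0 : 0 ≤ ∫ x, u x ∂μ - ∫ y, u y ∂ν) :
    ∀ᵐ x ∂μ, u x - u (T x) = ‖x - T x‖ := by
  have iμ := hμ.integrable hΩ hu.continuous.continuousOn
  have iν : Integrable u (μ.map T) := hTν ▸ hν.integrable hΩ hu.continuous.continuousOn
  have iT : Integrable (fun x => u (T x)) μ := iν.comp_aemeasurable hT
  have hm : AEStronglyMeasurable (fun x => ‖x - T x‖) μ :=
    (aemeasurable_id.sub hT).norm.aestronglyMeasurable
  have hlin : ∫⁻ x, ENNReal.ofReal ‖x - T x‖ ∂μ ≤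
      ENNReal.ofReal (∫ x, u x ∂μ - ∫ y, u y ∂ν) := by
    simpa only [edist_dist, dist_eq_norm] using hle
  have hi : Integrable (fun x => ‖x - T x‖) μ := by
    refine ⟨hm, ?_⟩
    rw [hasFiniteIntegral_iff_ofReal (Eventually.of_forall fun x => norm_nonneg _)]
    exact hlin.trans_lt ENNReal.ofReal_lt_top
  have hint : ∫ x, ‖x - T x‖ ∂μ ≤ ∫ x, u x ∂μ - ∫ y, u y ∂ν := by
    rw [integral_eq_lintegral_of_nonneg_ae (Eventually.of_forall fun x => norm_nonneg _) hm]
    exact ENNReal.toReal_le_of_le_ofReal h0 hlin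
  have hν' : ∫ y, u y ∂ν = ∫ x, u (T x) ∂μ := by
    rw [← hTν, integral_map hT iν.aestronglyMeasurable]
  have hnn : 0 ≤ fun x => ‖x - T x‖ - (u x - u (T x)) := fun x =>
    sub_nonneg.2 (sub_le_norm_sub_of_lipschitz hu _ _)
  have hz : ∫ x, (‖x - T x‖ - (u x - u (T x))) ∂μ = 0 := by
    refine le_antisymm ?_ (integral_nonneg hnn)
    have e1 : ∫ x, (u x - u (T x)) ∂μ = ∫ x, u x ∂μ - ∫ y, u y ∂ν := by
      rw [integral_sub iμ iT, hν']
    have e2 : ∫ x, (‖x - T x‖ - (u x - u (T x))) ∂μ =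
        ∫ x, ‖x - T x‖ ∂μ - ∫ x, (u x - u (T x)) ∂μ := integral_sub hi (iμ.sub iT)
    linarith
  filter_upwards [(integral_eq_zero_iff_of_nonneg hnn (hi.sub (iμ.sub iT))).1 hz] with x hx
  exact (sub_eq_zero.1 hx).symm

end Marginals

/-! ### Descending along the gradient of a potential -/

/-- The ascent map agrees with a globally Lipschitz map on a measurable set containing all points
that are reached by moving by `η` along a transport ray of length at least `l > η`: these points are
at distance at least `min η (l - η)` from both ends of the ray. -/
theorem exists_lipschitz_eqOn_ascent {d : ℕ} {u : E d → ℝ} (hu : LipschitzWith 1 u)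
    {η l : ℝ} (hη : 0 ≤ η) (hl : η < l) :
    ∃ (B : Set (E d)) (h : E d → E d) (C : ℝ≥0), MeasurableSet B ∧ LipschitzWith C h ∧
      Set.EqOn (fun x => x + η • gradient u x) h B ∧
      ∀ x y, DifferentiableAt ℝ u x → u x - u y = ‖x - y‖ → l ≤ ‖x - y‖ →
        x - η • gradient u x ∈ B := by
  -- For `η = 0` there is no margin at the upper end, but the ascent map is the identity.
  rcases hη.eq_or_lt with rfl | hη
  · exact ⟨Set.univ, id, 1, MeasurableSet.univ, LipschitzWith.id, fun x _ => by simp,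
      fun _ _ _ _ _ => Set.mem_univ _⟩
  · have hr : 0 < min η (l - η) := lt_min hη (sub_pos.2 hl)
    have hL : LipschitzOnWith (1 + ‖η‖₊ * (3 / min η (l - η)).toNNReal)
        (fun x => x + η • gradient u x) (rayInterior u (min η (l - η))) :=
      (LipschitzWith.id.lipschitzOnWith).add
        ((lipschitzWith_smul η).comp_lipschitzOnWith (lipschitzOnWith_gradient_rayInterior hu hr))
    obtain ⟨h, hh, heq⟩ := hL.extend_finite_dimension
    refine ⟨_, h, _, (isClosed_rayInterior hu.continuous _).measurableSet, hh, heq,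
      fun x y hd hxy hly => ?_⟩
    exact (descent_along_ray hu hd hxy hη.le (hl.trans_le hly)).2.2.2.1 _ hr (min_le_left _ _)
      ((min_le_right _ _).trans (by linarith))

theorem theorem1 {d : ℕ} {Ω : Set (E d)} (hΩ : IsCompact Ω) (hΩc : Convex ℝ Ω)
    {μ ν : Measure (E d)} (hμ : IsProbOn Ω μ) (hν : IsProbOn Ω ν)
    (hac : μ ≪ volume)
    {u₀ : E d → ℝ} (hu₀ : IsKantorovichPotential Ω μ ν u₀)
    {T₀ : E d → E d} (hT₀ : IsOptimalMap μ ν T₀)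
    {η₀ : ℝ} (hη₀ : 0 ≤ η₀) (hlt : η₀ < minTransportLength μ T₀)
    {μ₁ : Measure (E d)} (hμ₁ : μ₁ = μ.map (descentMap Ω u₀ η₀)) :
    -- the pushforward is again a probability measure on `Ω`
    IsProbOn Ω μ₁ ∧
    -- (i)
    IsKantorovichPotential Ω μ₁ ν u₀ ∧
    -- (ii)
    (W1 μ ν ≠ ∞ ∧ W1 μ₁ ν ≠ ∞ ∧ (W1 μ₁ ν).toReal = (W1 μ ν).toReal - η₀) ∧
    -- (iii)
    (IsOptimalMap μ₁ ν (T₀ ∘ ascentMap Ω u₀ η₀) ∧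
      minTransportLength μ T₀ - η₀ ≤ minTransportLength μ₁ (T₀ ∘ ascentMap Ω u₀ η₀)) ∧
    -- (iv)
    (μ₁ ≪ volume ∧ (∃ ρ₁ : E d → ℝ≥0∞, IsDensity ρ₁ μ₁) ∧
      ∀ ρ ρ₁ : E d → ℝ≥0∞, IsDensity ρ μ → IsDensity ρ₁ μ₁ →
        ∀ᵐ x ∂μ, ∃ L : E d →L[ℝ] E d,
          HasApproxFDerivAt (ascentMap Ω u₀ η₀) L (descentMap Ω u₀ η₀ x) ∧
          ρ₁ (descentMap Ω u₀ η₀ x) = ρ x * ENNReal.ofReal |L.det|) := by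
  have hprob := hμ.1
  have : Nontrivial (E d) := nontrivial_of_minTransportLength_pos (hη₀.trans_lt hlt)
  have hnull : NullSingletonClass μ := ⟨fun x => hac (measure_singleton x)⟩
  -- Pass to a Lipschitz extension of the potential, and to maps defined everywhere.
  obtain ⟨u, hu, huΩ⟩ := hu₀.lipschitz.extend_real
  have hint {m : Measure (E d)} (hm : IsProbOn Ω m) : ∫ x, u₀ x ∂m = ∫ x, u x ∂m :=
    integral_congr_ae (by filter_upwards [hm.ae_mem] with x hx using huΩ hx)
  set F : E d → E d := fun x => x - η₀ • gradient u x with hF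
  set G : E d → E d := fun x => x + η₀ • gradient u x with hG
  have hFm : Measurable F := measurable_id.sub ((measurable_gradient u).const_smul η₀)
  have hGm : Measurable G := measurable_id.add ((measurable_gradient u).const_smul η₀)
  set ℓ := minTransportLength μ T₀ with hℓ
  -- Duality and complementary slackness for `(μ, ν)`.
  have hle := hu₀.lintegral_optimalMap_le hΩ hμ hν hT₀
  obtain ⟨-, -, hW, hD0⟩ := optimality_of_lintegral_le_dual hΩ hμ hν hu₀.lipschitz
    hT₀.aemeasurable hT₀.map_eq hle
  have hray : ∀ᵐ x ∂μ, u x - u (T₀ x) = ‖x - T₀ x‖ := by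
    refine ae_sub_eq_norm_sub hΩ hμ hν hu hT₀.aemeasurable hT₀.map_eq ?_ ?_
    · rwa [← hint hμ, ← hint hν]
    · rwa [← hint hμ, ← hint hν]
  have hint_mem := hμ.ae_mem_interior hΩc hac
  have hTΩ : ∀ᵐ x ∂μ, T₀ x ∈ Ω :=
    ae_of_ae_map hT₀.aemeasurable (hT₀.map_eq.symm ▸ hν.ae_mem)
  have hdiff : ∀ᵐ x ∂μ, DifferentiableAt ℝ u x := hac.ae_le hu.ae_differentiableAt
  have hlen := ae_minTransportLength_le μ T₀
  have hfF : descentMap Ω u₀ η₀ =ᵐ[μ] F := by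
    filter_upwards [hint_mem] with x hx using descentMap_eq huΩ hx η₀
  have hμF : μ₁ = μ.map F := hμ₁.trans (Measure.map_congr hfF)
  -- The points `F x` lie in the interior of `Ω`, since `x` does and the ray ends in `Ω`.
  have hgood : ∀ᵐ x ∂μ, u (F x) = u x - η₀ ∧ ‖F x - T₀ x‖ = ‖x - T₀ x‖ - η₀ ∧
      F x ∈ interior Ω ∧ G (F x) = x := by
    filter_upwards [hray, hint_mem, hTΩ, hdiff, hlen] with x h1 h2 h3 h4 h5
    have h6 : η₀ < ‖x - T₀ x‖ := hlt.trans_le h5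
    obtain ⟨a1, a2, a3, -, a4⟩ := descent_along_ray hu h4 h1 hη₀ h6
    refine ⟨a1, a2, ?_, ?_⟩
    · simp only [hF]
      have hpos : 0 < ‖x - T₀ x‖ := hη₀.trans_lt h6
      rw [a3]
      refine hΩc.add_smul_sub_mem_interior h3 h2 ⟨sub_pos.2 ((div_lt_one hpos).2 h6), ?_⟩
      linarith [div_nonneg hη₀ hpos.le]
    · simp only [hF, hG]
      rw [a4, sub_add_cancel]
  have hμ₁Ω : IsProbOn Ω μ₁ := by
    rw [hμF]
    refine isProbOn_map hμ hΩ hFm.aemeasurable ?_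
    filter_upwards [hgood] with x hx using interior_subset hx.2.2.1
  have hint₁ : ∀ᵐ y ∂μ₁, y ∈ interior Ω := by
    rw [hμF]
    refine (ae_map_iff hFm.aemeasurable isOpen_interior.measurableSet).2 ?_
    filter_upwards [hgood] with x hx using hx.2.2.1
  have hgG : ascentMap Ω u₀ η₀ =ᵐ[μ₁] G := by
    filter_upwards [hint₁] with y hy using ascentMap_eq huΩ hy η₀
  have hGF : μ₁.map G = μ := by
    rw [hμF, Measure.map_map hGm hFm]
    refine (Measure.map_congr (g := id) ?_).trans Measure.map_id
    filter_upwards [hgood] with x hx using hx.2.2.2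
  have hTG : AEMeasurable (T₀ ∘ G) μ₁ :=
    AEMeasurable.comp_aemeasurable (hGF.symm ▸ hT₀.aemeasurable) hGm.aemeasurable
  have hTg : T₀ ∘ ascentMap Ω u₀ η₀ =ᵐ[μ₁] T₀ ∘ G := by
    filter_upwards [hgG] with y hy
    simp only [Function.comp_apply, hy]
  have hT₁ : AEMeasurable (T₀ ∘ ascentMap Ω u₀ η₀) μ₁ := hTG.congr hTg.symm
  have hT₁ν : μ₁.map (T₀ ∘ ascentMap Ω u₀ η₀) = ν := by
    rw [Measure.map_congr hTg, ← AEMeasurable.map_map_of_aemeasurable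
      (hGF.symm ▸ hT₀.aemeasurable) hGm.aemeasurable, hGF, hT₀.map_eq]
  -- Cost of the new map and dual value of `u` for `(μ₁, ν)`.
  have hdual : ∫ y, u₀ y ∂μ₁ - ∫ y, u₀ y ∂ν = ∫ x, u₀ x ∂μ - ∫ y, u₀ y ∂ν - η₀ := by
    have h1 : ∫ y, u y ∂μ₁ = ∫ x, u x ∂μ - η₀ := by
      rw [hμF, integral_map hFm.aemeasurable hu.continuous.aestronglyMeasurable]
      have h2 : ∫ x, u (F x) ∂μ = ∫ x, (u x - η₀) ∂μ :=
        integral_congr_ae (by filter_upwards [hgood] with x hx using hx.1)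
      rw [h2, integral_sub (hμ.integrable hΩ hu.continuous.continuousOn) (integrable_const _)]
      simp
    rw [hint hμ₁Ω, hint hμ, h1]
    ring
  have hcost : ∫⁻ y, edist y ((T₀ ∘ ascentMap Ω u₀ η₀) y) ∂μ₁ ≤
      ENNReal.ofReal (∫ y, u₀ y ∂μ₁ - ∫ y, u₀ y ∂ν) := by
    have h1 : ∫⁻ y, edist y ((T₀ ∘ ascentMap Ω u₀ η₀) y) ∂μ₁ =
        ∫⁻ y, edist y ((T₀ ∘ G) y) ∂μ₁ :=
      lintegral_congr_ae (by filter_upwards [hTg] with y hy using by rw [hy])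
    have h2 : ∫⁻ y, edist y ((T₀ ∘ G) y) ∂μ₁ = ∫⁻ x, edist (F x) (T₀ (G (F x))) ∂μ := by
      have hm : AEMeasurable (fun y => edist y ((T₀ ∘ G) y)) (μ.map F) :=
        hμF ▸ aemeasurable_id.edist hTG
      rw [hμF, lintegral_map' hm hFm.aemeasurable]
      rfl
    have h3 : ∫⁻ x, (edist (F x) (T₀ (G (F x))) + ENNReal.ofReal η₀) ∂μ =
        ∫⁻ x, edist x (T₀ x) ∂μ := by
      refine lintegral_congr_ae ?_
      filter_upwards [hgood, hlen] with x hx hx1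
      rw [hx.2.2.2, edist_dist, edist_dist, dist_eq_norm, dist_eq_norm, hx.2.1,
        ← ENNReal.ofReal_add (by linarith) hη₀, sub_add_cancel]
    rw [lintegral_add_right _ measurable_const, lintegral_const, measure_univ, mul_one] at h3
    rw [h1, h2, hdual, ENNReal.ofReal_sub _ hη₀]
    exact ENNReal.le_sub_of_add_le_right ENNReal.ofReal_ne_top (h3.trans_le hle)
  obtain ⟨hK, hopt, hW₁, hD₁⟩ := optimality_of_lintegral_le_dual hΩ hμ₁Ω hν hu₀.lipschitz
    hT₁ hT₁ν hcost
  -- The ascent map is Lipschitz on a set that carries `μ₁`.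
  obtain ⟨B, h, C, hB, hh, hGh, hmemB⟩ := exists_lipschitz_eqOn_ascent hu hη₀ hlt
  have hinv : ∀ᵐ x ∂μ, F x ∈ B ∧ G (F x) = x := by
    filter_upwards [hgood, hray, hdiff, hlen] with x h1 h2 h3 h4
    exact ⟨hmemB x _ h3 h2 h4, h1.2.2.2⟩
  have hac₁ : μ₁ ≪ volume :=
    hμF ▸ map_absolutelyContinuous_of_lipschitz_leftInverse hFm hh hGh hac hinv
  refine ⟨hμ₁Ω, hK, ⟨?_, ?_, ?_⟩, ⟨hopt, ?_⟩, hac₁, ?_, ?_⟩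
  · rw [hW]; exact ENNReal.ofReal_ne_top
  · rw [hW₁]; exact ENNReal.ofReal_ne_top
  · rw [hW, hW₁, ENNReal.toReal_ofReal hD₁, ENNReal.toReal_ofReal hD0, hdual]
  · have hnm : NullMeasurableSet {y | ℓ - η₀ ≤ ‖y - (T₀ ∘ ascentMap Ω u₀ η₀) y‖} μ₁ :=
      nullMeasurableSet_le aemeasurable_const (aemeasurable_id.sub hT₁).norm
    have hgf : ∀ᵐ x ∂μ, (T₀ ∘ ascentMap Ω u₀ η₀) (F x) = T₀ x := by
      filter_upwards [hgood] with x hx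
      rw [Function.comp_apply, ascentMap_eq huΩ hx.2.2.1]
      exact congrArg T₀ hx.2.2.2
    refine le_minTransportLength hμ₁Ω hΩ ?_ ?_
    · exact ae_of_ae_map hT₁ (hT₁ν.symm ▸ hν.ae_mem)
    · rw [hμF] at hnm ⊢
      refine ae_map_of_ae_nullMeasurable hFm.aemeasurable hnm ?_
      filter_upwards [hgood, hlen, hgf] with x h1 h2 h3
      rw [h3, h1.2.1]
      linarith
  · have := hμ₁Ω.1
    exact ⟨μ₁.rnDeriv volume, (Measure.measurable_rnDeriv _ _).aemeasurable,
      (Measure.withDensity_rnDeriv_eq _ _ hac₁).symm⟩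
  · rintro ρ ρ₁ ⟨hρm, hρ⟩ ⟨hρ₁m, hρ₁⟩
    have hjac := density_map_eq_mul_abs_det hFm hGm hh hB hGh hinv hρm.measurable_mk
      hρ₁m.measurable_mk (hρ.trans (withDensity_congr_ae hρm.ae_eq_mk))
      (hμF ▸ hρ₁.trans (withDensity_congr_ae hρ₁m.ae_eq_mk))
    have hρ' : ∀ᵐ x ∂μ, ρ x = hρm.mk ρ x := hac.ae_le hρm.ae_eq_mk
    have hvol {p : E d → Prop} (hp : ∀ᵐ y ∂volume, p y) : ∀ᵐ x ∂μ, p (F x) :=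
      ae_of_ae_map hFm.aemeasurable (hμF ▸ hac₁.ae_le hp)
    filter_upwards [hfF, hinv, hgood, hjac, hρ', hvol hρ₁m.ae_eq_mk,
      hvol hh.ae_differentiableAt,
      hvol (Besicovitch.ae_tendsto_measure_inter_div_of_measurableSet volume hB.compl)]
      with x h1 h2 h3 h4 h5 h6 h7 h8
    rw [h1, h6, h4, h5]
    refine ⟨fderiv ℝ h (F x), hasApproxFDerivAt_of_eqOn h7 (isOpen_interior.mem_nhds h3.2.2.1)
      h2.1 ?_ ?_, rfl⟩
    · intro y hy
      rw [ascentMap_eq huΩ hy.2]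
      exact hGh hy.1
    · rwa [Set.indicator_of_notMem (Set.notMem_compl_iff.2 h2.1)] at h8
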